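/- Let $K$ be a field of characteristic zero, let $n\ge 2$, and let $f\in K[x_1,\ldots,x_{n+1}]$ be a non-degenerate quadratic form. Let $\mathbb{L}(f)$ be the $(n+1)$-dimensional space with basis $e_1,\ldots,e_{n+1}$ and the skew-symmetric $n$-ary bracket given by $$[e_1,\ldots,\widehat{e_i},\ldots,e_{n+1}]=(-1)^{n-i+1}\frac{\partial f}{\partial x_i}(e_1,\ldots,e_{n+1}),\qquad 1\le i\le n+1.$$ Let $P(\mathbb{L}(f))$ be its $n$-Lie-Poisson enveloping algebra, that is, the polynomial algebra $K[e_1,\ldots,e_{n+1}]$ with the unique skew-symmetric $n$-ary bracket which is a derivation in each argument and extends the bracket of $\mathbb{L}(f)$; write $f$ also for $f(e_1,\ldots,e_{n+1})$. Then $\mathbb{L}(f)$ is a simple $n$-Lie algebra, and for every $0\neq\lambda\in K$ the ideal $(f-\lambda)$ is stable under the bracket of $P(\mathbb{L}(f))$ (i.e. $\{P,\ldots,(f-\lambda),\ldots,P\}\subseteq (f-\lambda)$ for $P=P(\mathbb{L}(f))$), the quotient $Q=P(\mathbb{L}(f))/(f-\lambda)$ with the induced bracket is an $n$-Lie-Poisson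 algebra, and $Q$ is central and simple: an element $c\in Q$ satisfies $\{c,q_2,\ldots,q_n\}=0$ for all $q_2,\ldots,q_n\in Q$ if and only if $c\in K$, and $Q\neq 0$ has no ideals $I$ of the associative algebra $Q$ with $\{Q,\ldots,Q,I\}\subseteq I$ except $0$ and $Q$. -/

import Mathlib

/-!
`n`-ary skew-symmetric operations on a `K`-module `V` are Mathlib's alternating maps
`V [⋀^Fin n]→ₗ[K] V`: multilinear maps that vanish when two arguments are equal.
-/

namespace NLie

section General

variable {K : Type*} [Field K] {n : ℕ}

/-- `V` with the skew-symmetric bracket `b` is an `n`-Lie algebra: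
every map `x ↦ [v₁, …, x, …, vₙ]` (with `x` in place `j`) is a derivation of the bracket.
By skew-symmetry the identities for the different places `j` are equivalent to one another. -/
def IsNLie {V : Type*} [AddCommGroup V] [Module K V] (b : V [⋀^Fin n]→ₗ[K] V) : Prop :=
  ∀ (j : Fin n) (u v : Fin n → V),
    b (Function.update v j (b u)) =
      ∑ i, b (Function.update u i (b (Function.update v j (u i))))

/-- An `n`-ary algebra is simple if its bracket is nonzero and every subspace `I` with
`[V, …, I, …, V] ⊆ I` is `0` or `V`. -/
def IsSimpleNAry {V : Type*} [AddCommGroup V] [Module K V] (b : V [⋀^Fin n]→ₗ[K] V) : Prop :=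
  b ≠ 0 ∧ ∀ I : Submodule K V,
    (∀ (v : Fin n → V) (i : Fin n), v i ∈ I → b v ∈ I) → I = ⊥ ∨ I = ⊤

variable {A : Type*} [CommRing A] [Algebra K A]

/-- The Leibniz identity: the bracket is a derivation in each argument. -/
def IsLeibniz (b : A [⋀^Fin n]→ₗ[K] A) : Prop :=
  ∀ (v : Fin n → A) (i : Fin n) (x y : A),
    b (Function.update v i (x * y)) =
      x * b (Function.update v i y) + b (Function.update v i x) * y

/-- The commutative associative algebra `A` with the bracket `b` is an
`n`-Lie-Poisson algebra. -/
structure IsNLiePoisson (b : A [⋀^Fin n]→ₗ[K] A) : Prop where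
  isNLie : IsNLie b
  leibniz : IsLeibniz b

/-- The center: all `c` such that every bracket with the argument `c` is zero. -/
def center (b : A [⋀^Fin n]→ₗ[K] A) : Set A :=
  {c | ∀ (v : Fin n → A) (i : Fin n), b (Function.update v i c) = 0}

/-- `A` with the bracket `b` is central over `K`: its center is `K · 1`. -/
def IsCentral (b : A [⋀^Fin n]→ₗ[K] A) : Prop :=
  center b = Set.range (algebraMap K A)

/-- The ideal `I` of the associative algebra `A` satisfies `{A, …, I, …, A} ⊆ I`. -/
def IsPoissonIdeal (b : A [⋀^Fin n]→ₗ[K] A) (I : Ideal A) : Prop :=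
  ∀ (v : Fin n → A) (i : Fin n), v i ∈ I → b v ∈ I

/-- `A ≠ 0`, and `A` has no Poisson ideals except `0` and `A`. -/
def IsSimplePoisson (b : A [⋀^Fin n]→ₗ[K] A) : Prop :=
  Nontrivial A ∧ ∀ I : Ideal A, IsPoissonIdeal b I → I = ⊥ ∨ I = ⊤

theorem IsPoissonIdeal.sub_mem {b : A [⋀^Fin n]→ₗ[K] A} {I : Ideal A}
    (h : IsPoissonIdeal b I) (u v : Fin n → A) (huv : ∀ i, u i - v i ∈ I) :
    b u - b v ∈ I := by
  have key : ∀ s : Finset (Fin n), b (s.piecewise u v) - b v ∈ I := by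
    intro s
    induction s using Finset.induction_on with
    | empty => simp
    | insert i s hi ih =>
      rw [Finset.piecewise_insert]
      have h1 : b (Function.update (s.piecewise u v) i (u i)) - b (s.piecewise u v) =
          b (Function.update (s.piecewise u v) i (u i - v i)) := by
        rw [b.map_update_sub]
        congr 2
        rw [eq_comm, Function.update_eq_self_iff]
        simp [hi]
      have h2 := h (Function.update (s.piecewise u v) i (u i - v i)) i (by simpa using huv i)
      rw [← h1] at h2
      simpa using I.add_mem h2 ih
  simpa using key Finset.univ

theorem IsPoissonIdeal.mk_eq {b : A [⋀^Fin n]→ₗ[K] A} {I : Ideal A}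
    (h : IsPoissonIdeal b I) {u v : Fin n → A}
    (huv : ∀ i, Ideal.Quotient.mk I (u i) = Ideal.Quotient.mk I (v i)) :
    Ideal.Quotient.mk I (b u) = Ideal.Quotient.mk I (b v) :=
  Ideal.Quotient.eq.2 (h.sub_mem u v fun i => Ideal.Quotient.eq.1 (huv i))

/-- The bracket induced on the quotient algebra `A ⧸ I` by a Poisson ideal `I`. -/
noncomputable def quotientBracket (b : A [⋀^Fin n]→ₗ[K] A) (I : Ideal A)
    (h : IsPoissonIdeal b I) : (A ⧸ I) [⋀^Fin n]→ₗ[K] (A ⧸ I) where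
  toFun q := Ideal.Quotient.mk I (b fun i => (q i).out)
  map_update_add' := by
    intro inst q i x y
    obtain rfl : inst = instDecidableEqFin n := Subsingleton.elim _ _
    have e : ∀ z : A ⧸ I, Ideal.Quotient.mk I (b fun j => (Function.update q i z j).out) =
        Ideal.Quotient.mk I (b (Function.update (fun j => (q j).out) i z.out)) := by
      intro z
      congr 2
      funext j
      by_cases hj : j = i
      · subst hj; simp
      · simp [hj]
    rw [e, e, e, ← map_add, ← b.map_update_add]
    apply h.mk_eq
    intro j
    by_cases hj : j = i
    · subst hj; simp
    · simp [hj]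
  map_update_smul' := by
    intro inst q i c x
    obtain rfl : inst = instDecidableEqFin n := Subsingleton.elim _ _
    have e : ∀ z : A ⧸ I, Ideal.Quotient.mk I (b fun j => (Function.update q i z j).out) =
        Ideal.Quotient.mk I (b (Function.update (fun j => (q j).out) i z.out)) := by
      intro z
      congr 2
      funext j
      by_cases hj : j = i
      · subst hj; simp
      · simp [hj]
    rw [e, e]
    have hs : ∀ a : A, c • Ideal.Quotient.mk I a = Ideal.Quotient.mk I (c • a) := fun _ => rfl
    rw [hs, ← b.map_update_smul]
    apply h.mk_eq
    intro j
    by_cases hj : j = i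
    · subst hj
      simp [← hs]
    · simp [hj]
  map_eq_zero_of_eq' := by
    intro q i j hq hij
    rw [b.map_eq_zero_of_eq _ (by simp [hq]) hij, map_zero]

/-- The quotient map is a homomorphism of brackets. -/
theorem quotientBracket_mk (b : A [⋀^Fin n]→ₗ[K] A) (I : Ideal A)
    (h : IsPoissonIdeal b I) (v : Fin n → A) :
    quotientBracket b I h (fun i => Ideal.Quotient.mk I (v i)) =
      Ideal.Quotient.mk I (b v) :=
  h.mk_eq (b := b) fun i => by simp

end General

section Enveloping

open MvPolynomial

variable {K : Type*} [Field K] {n : ℕ} {ι : Type*} [Fintype ι]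
  {V : Type*} [AddCommGroup V] [Module K V]

/-- An element of `V` as a linear form in `K[e_i : i ∈ ι]`, for a basis `(e_i)` of `V`. -/
noncomputable def linForm (e : Module.Basis ι K V) : V →ₗ[K] MvPolynomial ι K :=
  e.constr K X

/-- The bracket of the Poisson enveloping algebra of the `n`-ary algebra `(V, b)` with the
finite basis `(e_i)`: the bracket on `K[e_i : i ∈ ι]` that satisfies the Leibniz identity and
extends `b`, that is,
`{a₁, …, aₙ} = ∑ ∂a₁/∂e_{i₁} ⋯ ∂aₙ/∂e_{iₙ} [e_{i₁}, …, e_{iₙ}]`. -/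
noncomputable def envelopingBracket (e : Module.Basis ι K V) (b : V [⋀^Fin n]→ₗ[K] V) :
    (MvPolynomial ι K) [⋀^Fin n]→ₗ[K] (MvPolynomial ι K) :=
  { ∑ i : Fin n → ι,
      (LinearMap.mulRight K (linForm e (b fun k => e (i k)))).compMultilinearMap
        ((MultilinearMap.mkPiAlgebra K (Fin n) (MvPolynomial ι K)).compLinearMap
          fun k => (pderiv (i k) : Derivation K (MvPolynomial ι K) _).toLinearMap) with
    map_eq_zero_of_eq' := by
      intro a p q hpq hne
      simp only [MultilinearMap.toFun_eq_coe, sum_apply]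
      refine Finset.sum_involution (fun i _ => i ∘ Equiv.swap p q) ?_ ?_ ?_ ?_
      · intro i _
        have h1 : (b fun k => e ((i ∘ Equiv.swap p q) k)) = - b fun k => e (i k) :=
          b.map_swap (fun k => e (i k)) hne
        have h2 : ∏ k, pderiv ((i ∘ Equiv.swap p q) k) (a k) = ∏ k, pderiv (i k) (a k) := by
          rw [← Equiv.prod_comp (Equiv.swap p q) fun k => pderiv (i k) (a k)]
          refine Finset.prod_congr rfl fun k _ => ?_
          have : a (Equiv.swap p q k) = a k := by
            rcases eq_or_ne k p with rfl | hp
            · simp [hpq]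
            · rcases eq_or_ne k q with rfl | hq
              · simp [hpq]
              · rw [Equiv.swap_apply_of_ne_of_ne hp hq]
          rw [this]; rfl
        simp only [LinearMap.compMultilinearMap_apply, MultilinearMap.compLinearMap_apply,
          MultilinearMap.mkPiAlgebra_apply, LinearMap.mulRight_apply, Derivation.coeFn_coe, h1, h2, map_neg]
        ring
      · intro i _ hi h
        apply hi
        have hpq' : e (i p) = e (i q) := by
          have := congrFun h p
          simp at this
          rw [this]
        simp [b.map_eq_zero_of_eq (fun k => e (i k)) hpq' hne]
      · intro i _; simp
      · intro i _; funext k; simp }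

theorem envelopingBracket_apply (e : Module.Basis ι K V) (b : V [⋀^Fin n]→ₗ[K] V)
    (a : Fin n → MvPolynomial ι K) :
    envelopingBracket e b a =
      ∑ i : Fin n → ι, (∏ k, pderiv (i k) (a k)) * linForm e (b fun k => e (i k)) := by
  change (∑ i : Fin n → ι, _ : MultilinearMap K _ _) a = _
  simp

/-- On the generators the bracket is the bracket of the `n`-ary algebra. -/
theorem envelopingBracket_X (e : Module.Basis ι K V) (b : V [⋀^Fin n]→ₗ[K] V)
    (i : Fin n → ι) :
    envelopingBracket e b (fun k => X (i k)) = linForm e (b fun k => e (i k)) := by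
  classical
  rw [envelopingBracket_apply, Finset.sum_eq_single i]
  · simp
  · intro j _ hj
    obtain ⟨k, hk⟩ := Function.ne_iff.1 hj
    rw [Finset.prod_eq_zero (Finset.mem_univ k), zero_mul]
    rw [pderiv_X_of_ne (Ne.symm hk)]
  · simp

theorem envelopingBracket_isLeibniz (e : Module.Basis ι K V) (b : V [⋀^Fin n]→ₗ[K] V) :
    IsLeibniz (envelopingBracket e b) := by
  intro v i x y
  simp only [envelopingBracket_apply, Finset.mul_sum, Finset.sum_mul, ← Finset.sum_add_distrib]
  refine Finset.sum_congr rfl fun j _ => ?_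
  have h : ∀ z, ∏ k, pderiv (j k) (Function.update v i z k) =
      pderiv (j i) z * ∏ k ∈ Finset.univ.erase i, pderiv (j k) (v k) := by
    intro z
    rw [← Finset.mul_prod_erase _ _ (Finset.mem_univ i), Function.update_self]
    congr 1
    refine Finset.prod_congr rfl fun k hk => ?_
    rw [Function.update_of_ne (Finset.ne_of_mem_erase hk)]
  simp only [h, Derivation.leibniz, smul_eq_mul]
  ring

end Enveloping

section QuadraticForm

open MvPolynomial

variable {K : Type*} [Field K] {n : ℕ}

/-- A quadratic form `f`, given as a polynomial, is non-degenerate: its polar form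
`f(x + y) - f(x) - f(y)` has zero kernel. -/
def IsNondegenerate {m : ℕ} (f : MvPolynomial (Fin m) K) : Prop :=
  ∀ x : Fin m → K,
    (∀ y : Fin m → K, QuadraticMap.polar (fun z => eval z f) x y = 0) → x = 0

/-- The vector `(∂f/∂x_i)(e_0, …, e_{m-1})` of `K^m`, for the standard basis `(e_j)` and a
quadratic form `f`: the linear form `∂f/∂x_i` with `e_j` in place of `x_j`. -/
noncomputable def gradVec {m : ℕ} (f : MvPolynomial (Fin m) K) (i : Fin m) : Fin m → K :=
  ∑ j, coeff (Finsupp.single j 1) (pderiv i f) • Pi.basisFun K (Fin m) j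

/-- The bracket of `𝕃(f)` on `K^(n+1)`, for a quadratic form `f`. Indices start from `0`, so
that it is the alternating map with
`[e_0, …, ê_i, …, e_n] = (-1)^(n-i) (∂f/∂x_i)(e_0, …, e_n)` for `0 ≤ i ≤ n`.
The determinant is that of the matrix with rows `v_1, …, v_n` and its column `i` deleted. -/
noncomputable def quadBracket (f : MvPolynomial (Fin (n + 1)) K) :
    (Fin (n + 1) → K) [⋀^Fin n]→ₗ[K] (Fin (n + 1) → K) :=
  ∑ i : Fin (n + 1),
    (LinearMap.toSpanSingleton K (Fin (n + 1) → K)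
        ((-1 : K) ^ (n - (i : ℕ)) • gradVec f i)).compAlternatingMap
      ((Matrix.detRowAlternating (R := K) (n := Fin n)).compLinearMap
        (LinearMap.funLeft K K i.succAbove))

theorem quadBracket_apply (f : MvPolynomial (Fin (n + 1)) K) (v : Fin n → Fin (n + 1) → K) :
    quadBracket f v = ∑ i : Fin (n + 1),
      (Matrix.of fun k l => v k (i.succAbove l)).det •
        ((-1 : K) ^ (n - (i : ℕ)) • gradVec f i) := by
  have hsum : ∀ (s : Finset (Fin (n + 1)))
      (g : Fin (n + 1) → (Fin (n + 1) → K) [⋀^Fin n]→ₗ[K] (Fin (n + 1) → K)),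
      (∑ i ∈ s, g i) v = ∑ i ∈ s, g i v := by
    intro s g
    induction s using Finset.induction_on with
    | empty => simp
    | insert i s hi ih => rw [Finset.sum_insert hi, Finset.sum_insert hi, AlternatingMap.add_apply, ih]
  rw [quadBracket, hsum]
  rfl

theorem quadBracket_basis (f : MvPolynomial (Fin (n + 1)) K) (i : Fin (n + 1)) :
    quadBracket f (fun k => Pi.basisFun K (Fin (n + 1)) (i.succAbove k)) =
      (-1 : K) ^ (n - (i : ℕ)) • gradVec f i := by
  have key : ∀ j : Fin (n + 1), (Matrix.of fun k l =>
      Pi.basisFun K (Fin (n + 1)) (i.succAbove k) (j.succAbove l)).det =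
        if j = i then 1 else 0 := by
    intro j
    split_ifs with h
    · subst h
      rw [← Matrix.det_one (n := Fin n)]
      congr 1
      ext k l
      simp [Pi.single_apply, Matrix.one_apply, eq_comm]
    · obtain ⟨k, hk⟩ := Fin.exists_succAbove_eq h
      apply Matrix.det_eq_zero_of_row_eq_zero k
      intro l
      simp [hk, Fin.succAbove_ne]
  rw [quadBracket_apply]
  simp_rw [key]
  simp

/-- The bracket of the Poisson enveloping algebra `P(𝕃(f)) = K[x_0, …, x_n]`. -/
noncomputable abbrev polyBracket (f : MvPolynomial (Fin (n + 1)) K) :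
    (MvPolynomial (Fin (n + 1)) K) [⋀^Fin n]→ₗ[K] (MvPolynomial (Fin (n + 1)) K) :=
  envelopingBracket (Pi.basisFun K (Fin (n + 1))) (quadBracket f)

end QuadraticForm

end NLie

namespace NLie

open MvPolynomial

/-! ### Jacobian determinants and derivations. -/

section Jacobian

variable {σ R : Type*} [Fintype σ] [DecidableEq σ] [CommRing R]

/-! The bracket of `P(𝕃(f))` is a Jacobian determinant, `{a₁, …, aₙ} = jac (a₁, …, aₙ, f)`
(`polyBracket_eq_jac`). With all arguments but one fixed it is a derivation `D` that is divergence
free and kills `f`. Divergence-free derivations distribute over Jacobians (`derivation_jac`), which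
is the `n`-Lie identity; linear forms carry it back to `𝕃(f)`. Since `D (f - c) = 0`, the ideal `(f
- c)` is stable.

Simplicity of `𝕃(f)` is linear algebra. The gradient vectors `g_b` form a basis, and bracketing `v`
with basis vectors gives `±(v_a g_b - v_b g_a)`. Hence an ideal containing `v ≠ 0` contains the
hyperplane of all `∑ c_b g_b` with `c · v = 0`. For `n ≥ 2` it then has two independent elements,
and two distinct hyperplanes span everything.

For the quotient, brackets with variables yield the infinitesimal rotations preserving `f`. Their
Casimir element acts on harmonic polynomials of degree `d` by `2d(d - 1 + n)`, and these scalars are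
distinct (`casimir_eq`). Modulo `f - c` every polynomial is a sum of harmonic ones, because `f^k h ≡
c^k h` (`exists_sub_sum_harmonic_mem`). So a rotation-stable ideal contains the harmonic components
of such a sum when it contains the sum (`mem_of_sum_harmonic_mem`). A central element is killed by
the Casimir element modulo `f - c`, hence only its degree 0 part survives. A nonzero Poisson ideal
contains, after pulling back, a nonzero homogeneous polynomial; as `f ≡ c` is invertible, rotations
generate its partial derivatives, and differentiation descends to a nonzero constant. -/

theorem derivation_comm_of_X {σ R : Type*} [CommRing R]
    {D E : Derivation R (MvPolynomial σ R) (MvPolynomial σ R)}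
    (h : ∀ i, D (E (X i)) = E (D (X i))) (p : MvPolynomial σ R) : D (E p) = E (D p) := by
  have : ⁅D, E⁆ = 0 := by
    apply MvPolynomial.derivation_ext
    intro i
    simp [Derivation.commutator_apply, h i]
  have h2 := DFunLike.congr_fun this p
  simpa [Derivation.commutator_apply, sub_eq_zero] using h2

theorem pderiv_comm {σ R : Type*} [CommRing R] (i j : σ) (p : MvPolynomial σ R) :
    pderiv i (pderiv j p) = pderiv j (pderiv i p) := by
  classical
  apply derivation_comm_of_X
  intro k
  rw [pderiv_X, pderiv_X, Pi.single_apply, Pi.single_apply]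
  split_ifs <;> simp

theorem derivation_eq_sum_pderiv (D : Derivation R (MvPolynomial σ R) (MvPolynomial σ R))
    (p : MvPolynomial σ R) : D p = ∑ i, pderiv i p * D (X i) := by
  have : D = ∑ i, (D (X i)) • (pderiv i : Derivation R (MvPolynomial σ R) _) := by
    apply MvPolynomial.derivation_ext
    intro k
    rw [← Derivation.coeFnAddMonoidHom_apply (∑ i, _), map_sum, Finset.sum_apply]
    simp [pderiv_X, Pi.single_apply]
  conv_lhs => rw [this]
  rw [← Derivation.coeFnAddMonoidHom_apply, map_sum, Finset.sum_apply]
  simp [mul_comm]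

theorem det_updateRow_eq_sum {A : Type*} [CommRing A] (M : Matrix σ σ A) (k : σ) (r : σ → A) :
    (M.updateRow k r).det = ∑ l, r l * M.adjugate l k := by
  rw [← Matrix.cramer_transpose_apply, Matrix.cramer_eq_adjugate_mulVec, ← Matrix.adjugate_transpose]
  simp [Matrix.mulVec, dotProduct, mul_comm]

theorem derivation_prod {ι A : Type*} [DecidableEq ι] [CommRing A] [Algebra R A] (D : Derivation R A A)
    (s : Finset ι) (g : ι → A) : D (∏ i ∈ s, g i) = ∑ k ∈ s, D (g k) * ∏ i ∈ s.erase k, g i := by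
  induction s using Finset.induction_on with
  | empty => simp
  | insert a s ha ih =>
    rw [Finset.prod_insert ha, D.leibniz, ih, Finset.sum_insert ha, Finset.erase_insert ha,
      smul_eq_mul, smul_eq_mul, add_comm, mul_comm, Finset.mul_sum]
    congr 1
    refine Finset.sum_congr rfl fun k hk => ?_
    have hka : a ≠ k := fun h => ha (h ▸ hk)
    rw [Finset.erase_insert_of_ne hka,
      Finset.prod_insert (fun h => ha (Finset.mem_of_mem_erase h))]
    ring

theorem derivation_det {A : Type*} [CommRing A] [Algebra R A] (D : Derivation R A A)
    (M : Matrix σ σ A) : D M.det = ∑ k, (M.updateRow k fun l => D (M k l)).det := by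
  -- The transpose makes the product run over rows, so that the Leibniz rule differentiates row by
  -- row.
  have row : ∀ N : Matrix σ σ A, N.det = ∑ τ : Equiv.Perm σ,
      (Equiv.Perm.sign τ : ℤ) • ∏ i, N i (τ i) := by
    intro N
    rw [← Matrix.det_transpose, Matrix.det_apply]
    rfl
  simp_rw [row]
  rw [map_sum, Finset.sum_comm]
  refine Finset.sum_congr rfl fun τ _ => ?_
  rw [← Finset.smul_sum, map_zsmul, derivation_prod]
  congr 1
  refine Finset.sum_congr rfl fun k _ => ?_
  rw [← Finset.mul_prod_erase _ _ (Finset.mem_univ k), Matrix.updateRow_self]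
  congr 1
  refine Finset.prod_congr rfl fun i hi => ?_
  rw [Matrix.updateRow_ne (Finset.ne_of_mem_erase hi)]

/-- The Jacobian determinant of a family of polynomials. -/
noncomputable def jac (w : σ → MvPolynomial σ R) : MvPolynomial σ R :=
  (Matrix.of fun k l => pderiv l (w k)).det

theorem jac_update (w : σ → MvPolynomial σ R) (k : σ) (q : MvPolynomial σ R) :
    jac (Function.update w k q) =
      ((Matrix.of fun k l => pderiv l (w k)).updateRow k fun l => pderiv l q).det := by
  unfold jac
  congr 1
  ext i l
  rcases eq_or_ne i k with rfl | h
  · simp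
  · simp [h]

theorem jac_update_eq_sum (w : σ → MvPolynomial σ R) (k : σ) (q : MvPolynomial σ R) :
    jac (Function.update w k q) = ∑ l, pderiv l q * jac (Function.update w k (X l)) := by
  simp_rw [jac_update, det_updateRow_eq_sum]
  refine Finset.sum_congr rfl fun l _ => ?_
  simp [pderiv_X, Pi.single_apply]

theorem jac_eq_zero_of_eq (w : σ → MvPolynomial σ R) {i j : σ} (hij : i ≠ j) (h : w i = w j) :
    jac w = 0 :=
  Matrix.det_zero_of_row_eq hij (by ext l; simp [h])

theorem jac_comp_perm (w : σ → MvPolynomial σ R) (τ : Equiv.Perm σ) :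
    jac (w ∘ τ) = Equiv.Perm.sign τ * jac w :=
  Matrix.det_permute τ (Matrix.of fun k l => pderiv l (w k))

/-- The Jacobian determinant as a derivation in its argument in place `j`. -/
noncomputable def jacDerivation (w : σ → MvPolynomial σ R) (j : σ) :
    Derivation R (MvPolynomial σ R) (MvPolynomial σ R) :=
  mkDerivation R fun l => jac (Function.update w j (X l))

theorem jacDerivation_apply (w : σ → MvPolynomial σ R) (j : σ) (q : MvPolynomial σ R) :
    jacDerivation w j q = jac (Function.update w j q) := by
  rw [derivation_eq_sum_pderiv, jac_update_eq_sum]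
  simp [jacDerivation]

/-- This is the Lie derivative of a volume form. Commuting `D` past `∂_l` adds to the Jacobian
matrix its product with the matrix of partials of `D`; to first order this changes the determinant
by a trace, the divergence of `D`. -/
theorem derivation_jac (D : Derivation R (MvPolynomial σ R) (MvPolynomial σ R))
    (w : σ → MvPolynomial σ R) :
    D (jac w) + (∑ p, pderiv p (D (X p))) * jac w =
      ∑ k, jac (Function.update w k (D (w k))) := by
  set J : Matrix σ σ (MvPolynomial σ R) := Matrix.of fun k l => pderiv l (w k) with hJ
  have h1 : ∀ l q, pderiv l (D q) = D (pderiv l q) + ∑ p, pderiv p q * pderiv l (D (X p)) := by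
    intro l q
    rw [derivation_eq_sum_pderiv D q, map_sum, derivation_eq_sum_pderiv D (pderiv l q),
      ← Finset.sum_add_distrib]
    refine Finset.sum_congr rfl fun p _ => ?_
    rw [Derivation.leibniz, pderiv_comm l p]
    simp only [smul_eq_mul]
    ring
  have h2 : ∀ l p, ∑ k, J k p * J.adjugate l k = if l = p then J.det else 0 := by
    intro l p
    have := congrFun (congrFun J.adjugate_mul l) p
    simp only [Matrix.mul_apply, Matrix.smul_apply, Matrix.one_apply] at this
    simp_rw [mul_comm (J _ _), this]
    simp
  have h3 : ∀ k, jac (Function.update w k (D (w k))) =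
      ∑ l, D (pderiv l (w k)) * J.adjugate l k +
        ∑ l, (∑ p, pderiv p (w k) * pderiv l (D (X p))) * J.adjugate l k := by
    intro k
    rw [jac_update, ← hJ, det_updateRow_eq_sum, ← Finset.sum_add_distrib]
    exact Finset.sum_congr rfl fun l _ => by rw [h1, add_mul]
  simp_rw [h3, Finset.sum_add_distrib]
  congr 1
  · rw [jac, ← hJ, derivation_det]
    simp_rw [det_updateRow_eq_sum]
    rfl
  · rw [Finset.sum_comm, Finset.sum_mul]
    refine Finset.sum_congr rfl fun l _ => ?_
    simp_rw [Finset.sum_mul]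
    rw [Finset.sum_comm]
    have : ∀ p, ∑ k, pderiv p (w k) * pderiv l (D (X p)) * J.adjugate l k =
        pderiv l (D (X p)) * if l = p then J.det else 0 := by
      intro p
      rw [← h2, Finset.mul_sum]
      refine Finset.sum_congr rfl fun k _ => ?_
      simp only [hJ, Matrix.of_apply]
      ring
    simp [this, jac, ← hJ]

theorem pderiv_jac (p : σ) (w : σ → MvPolynomial σ R) :
    pderiv p (jac w) = ∑ k, jac (Function.update w k (pderiv p (w k))) := by
  have h : ∀ q : σ, pderiv q (pderiv p (X q) : MvPolynomial σ R) = 0 := by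
    intro q
    rw [pderiv_X, Pi.single_apply]
    split_ifs <;> simp
  have h2 := derivation_jac (pderiv p) w
  simp only [h, Finset.sum_const_zero, zero_mul, add_zero] at h2
  exact h2

theorem jac_update_update_swap (w : σ → MvPolynomial σ R) {j k : σ} (hjk : j ≠ k)
    (p q : MvPolynomial σ R) :
    jac (Function.update (Function.update w j p) k q) =
      - jac (Function.update (Function.update w j q) k p) := by
  have h : Function.update (Function.update w j p) k q =
      Function.update (Function.update w j q) k p ∘ Equiv.swap j k := by
    funext i
    rcases eq_or_ne i j with rfl | hj
    · simp [hjk]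
    rcases eq_or_ne i k with rfl | hk
    · simp [hjk]
    simp [Equiv.swap_apply_of_ne_of_ne hj hk, hj, hk]
  rw [h, jac_comp_perm, Equiv.Perm.sign_swap hjk]
  simp

/-- The vector field `q ↦ jac (w₁, …, q, …, wₘ)` is divergence free. -/
theorem sum_pderiv_jac_update_X {K : Type*} [Field K] [CharZero K] (w : σ → MvPolynomial σ K)
    (j : σ) : ∑ p, pderiv p (jac (Function.update w j (X p))) = 0 := by
  have h1 : ∀ p, pderiv p (jac (Function.update w j (X p))) =
      ∑ k ∈ Finset.univ.erase j, ∑ q, pderiv q (pderiv p (w k)) *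
        jac (Function.update (Function.update w j (X p)) k (X q)) := by
    intro p
    rw [pderiv_jac, ← Finset.add_sum_erase _ _ (Finset.mem_univ j), jac_update_eq_sum]
    simp only [Function.update_self, pderiv_X_self, pderiv_one, zero_mul, Finset.sum_const_zero,
      zero_add]
    refine Finset.sum_congr rfl fun k hk => ?_
    rw [jac_update_eq_sum, Function.update_of_ne (Finset.ne_of_mem_erase hk)]
  simp_rw [h1]
  rw [Finset.sum_comm]
  refine Finset.sum_eq_zero fun k hk => ?_
  -- Second derivatives are symmetric in `p, q` and the Jacobian is antisymmetric, so exchanging the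
  -- indices negates the sum.
  have h2 : ∀ S : MvPolynomial σ K, S = -S → S = 0 := fun S hS => self_eq_neg.1 hS
  apply h2
  conv_lhs => rw [Finset.sum_comm]
  rw [← Finset.sum_neg_distrib]
  refine Finset.sum_congr rfl fun p _ => ?_
  rw [← Finset.sum_neg_distrib]
  refine Finset.sum_congr rfl fun q _ => ?_
  rw [pderiv_comm, jac_update_update_swap w (Finset.ne_of_mem_erase hk).symm]
  ring

theorem jac_update_jac {K : Type*} [Field K] [CharZero K] (u v : σ → MvPolynomial σ K) (j : σ) :
    jac (Function.update v j (jac u)) =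
      ∑ k, jac (Function.update u k (jac (Function.update v j (u k)))) := by
  have h := derivation_jac (jacDerivation v j) u
  simp only [jacDerivation_apply, sum_pderiv_jac_update_X, zero_mul, add_zero] at h
  exact h

/-- The matrix is a rank-two perturbation `1 + U V` of the identity, and `det (1 + U V) = det (1 + V
U)` reduces it to size two. -/
theorem det_one_updateRow_updateRow {A : Type*} [CommRing A] {a b : σ} (hab : a ≠ b)
    (r s : σ → A) :
    (((1 : Matrix σ σ A).updateRow a r).updateRow b s).det = r a * s b - r b * s a := by
  let U : Matrix σ (Fin 2) A := Matrix.of fun k c => if k = ![a, b] c then 1 else 0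
  let V : Matrix (Fin 2) σ A := Matrix.of ![fun l => r l - if a = l then 1 else 0,
    fun l => s l - if b = l then 1 else 0]
  have h : ((1 : Matrix σ σ A).updateRow a r).updateRow b s = 1 + U * V := by
    ext k l
    rw [Matrix.add_apply, Matrix.mul_apply, Fin.sum_univ_two, Matrix.one_apply]
    rcases eq_or_ne k b with rfl | hb
    · simp [U, V, hab.symm]
    rcases eq_or_ne k a with rfl | ha
    · simp [U, V, hab]
    · simp [U, V, ha, hb, Matrix.one_apply]
  have h2 : ∀ c d, (V * U) c d = V c (![a, b] d) := by
    intro c d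
    simp [U, Matrix.mul_apply]
  rw [h, Matrix.det_one_add_mul_comm, Matrix.det_fin_two]
  simp only [Matrix.add_apply, h2]
  simp [V, hab, hab.symm]

theorem jac_X_update_update {a b : σ} (hab : a ≠ b) (p q : MvPolynomial σ R) :
    jac (Function.update (Function.update X a p) b q) =
      pderiv a p * pderiv b q - pderiv b p * pderiv a q := by
  have h := det_one_updateRow_updateRow hab (fun l => pderiv l p) fun l => pderiv l q
  rw [jac_update, ← h]
  congr 2
  ext i l
  rcases eq_or_ne i a with rfl | h
  · simp
  · simp [h, pderiv_X, Pi.single_apply, Matrix.one_apply]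

end Jacobian

/-! ### Passage to the quotient by a Poisson ideal. -/

section Quotient

variable {K : Type*} [Field K] {n : ℕ} {A : Type*} [CommRing A] [Algebra K A]
  {b : A [⋀^Fin n]→ₗ[K] A} {I : Ideal A} (h : IsPoissonIdeal b I)

theorem quotientBracket_update_mk (v : Fin n → A) (j : Fin n) (x : A) :
    quotientBracket b I h (Function.update (fun i => Ideal.Quotient.mk I (v i)) j
      (Ideal.Quotient.mk I x)) = Ideal.Quotient.mk I (b (Function.update v j x)) := by
  rw [← quotientBracket_mk b I h]
  congr 1
  funext i
  rcases eq_or_ne i j with rfl | hi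
  · simp
  · simp [hi]

theorem exists_eq_mk (q : Fin n → A ⧸ I) : ∃ v : Fin n → A, q = fun i => Ideal.Quotient.mk I (v i) :=
  ⟨fun i => (q i).out, by simp⟩

theorem IsNLiePoisson.quotientBracket (hb : IsNLiePoisson b) :
    IsNLiePoisson (quotientBracket b I h) where
  isNLie := by
    intro j u v
    obtain ⟨u, rfl⟩ := exists_eq_mk u
    obtain ⟨v, rfl⟩ := exists_eq_mk v
    simp only [quotientBracket_mk, quotientBracket_update_mk, hb.isNLie j u v, map_sum]
  leibniz := by
    intro v i x y
    obtain ⟨v, rfl⟩ := exists_eq_mk v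
    obtain ⟨x, rfl⟩ := Ideal.Quotient.mk_surjective x
    obtain ⟨y, rfl⟩ := Ideal.Quotient.mk_surjective y
    simp only [← map_mul, quotientBracket_update_mk, hb.leibniz v i x y, map_add]

theorem mk_mem_center_quotientBracket {a : A}
    (ha : Ideal.Quotient.mk I a ∈ center (quotientBracket b I h)) (v : Fin n → A) (i : Fin n) :
    b (Function.update v i a) ∈ I := by
  have := ha (fun i => Ideal.Quotient.mk I (v i)) i
  rwa [quotientBracket_update_mk, Ideal.Quotient.eq_zero_iff_mem] at this

theorem IsPoissonIdeal.comap_mk {J : Ideal (A ⧸ I)} (hJ : IsPoissonIdeal (quotientBracket b I h) J) :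
    IsPoissonIdeal b (J.comap (Ideal.Quotient.mk I)) := by
  intro v i hv
  rw [Ideal.mem_comap, ← quotientBracket_mk b I h]
  exact hJ _ i hv

end Quotient

/-! ### Linear forms as a copy of `𝕃(f)` inside the polynomial algebra. -/

section LinForm

variable {K : Type*} [Field K] {ι : Type*} [Fintype ι]

theorem linForm_basisFun (v : ι → K) :
    linForm (Pi.basisFun K ι) v = ∑ i, C (v i) * X i := by
  rw [linForm, Module.Basis.constr_apply_fintype]
  simp [smul_eq_C_mul]

theorem pderiv_linForm [DecidableEq ι] (v : ι → K) (i : ι) :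
    pderiv i (linForm (Pi.basisFun K ι) v) = C (v i) := by
  rw [linForm_basisFun, map_sum]
  simp [pderiv_X, Pi.single_apply]

theorem linForm_injective : Function.Injective (linForm (Pi.basisFun K ι)) := by
  classical
  intro v w h
  funext i
  have := congrArg (pderiv i) h
  rw [pderiv_linForm, pderiv_linForm] at this
  exact C_injective _ _ this

theorem linForm_coeff_of_isHomogeneous [DecidableEq ι] {g : MvPolynomial ι K}
    (hg : g.IsHomogeneous 1) :
    linForm (Pi.basisFun K ι) (fun j => coeff (Finsupp.single j 1) g) = g := by
  rw [linForm_basisFun]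
  have h := hg.sum_X_mul_pderiv
  rw [one_smul] at h
  conv_rhs => rw [← h]
  refine Finset.sum_congr rfl fun j _ => ?_
  have h0 := hg.pderiv (i := j)
  rw [← totalDegree_zero_iff_isHomogeneous, totalDegree_eq_zero_iff_eq_C, coeff_pderiv] at h0
  rw [h0]
  simp [mul_comm]

variable {n : ℕ}

/-- Partial derivatives of linear forms are their coefficients, so both sides are the multilinear
expansion of `b v` in the basis. Identities of the polynomial bracket thereby descend to `b`. -/
theorem linForm_quadBracket (b : (ι → K) [⋀^Fin n]→ₗ[K] (ι → K)) (v : Fin n → ι → K) :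
    linForm (Pi.basisFun K ι) (b v) =
      envelopingBracket (Pi.basisFun K ι) b fun k => linForm (Pi.basisFun K ι) (v k) := by
  classical
  rw [envelopingBracket_apply]
  have hv : b v = ∑ i : Fin n → ι, (∏ k, v k (i k)) • b fun k => Pi.basisFun K ι (i k) := by
    have h : v = fun k => ∑ i, v k i • Pi.basisFun K ι i := by
      funext k
      exact ((Pi.basisFun K ι).sum_repr (v k)).symm
    conv_lhs => rw [h]
    refine (b.toMultilinearMap.map_sum _).trans (Finset.sum_congr rfl fun i _ => ?_)
    exact b.map_smul_univ _ _
  rw [hv, map_sum]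
  refine Finset.sum_congr rfl fun i _ => ?_
  simp only [pderiv_linForm, map_smul, ← map_prod, smul_eq_C_mul]

theorem gradVec_apply {m : ℕ} (f : MvPolynomial (Fin m) K) (i j : Fin m) :
    gradVec f i j = coeff (Finsupp.single j 1) (pderiv i f) := by
  simp [gradVec, Finset.sum_apply, Pi.single_apply]

theorem linForm_gradVec {m : ℕ} {f : MvPolynomial (Fin m) K} (hf : f.IsHomogeneous 2)
    (i : Fin m) : linForm (Pi.basisFun K (Fin m)) (gradVec f i) = pderiv i f := by
  rw [← linForm_coeff_of_isHomogeneous (hf.pderiv (i := i))]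
  congr 1
  funext j
  exact gradVec_apply f i j

end LinForm

/-! ### The enveloping bracket as a Jacobian. -/

section PolyBracket

variable {K : Type*} [Field K] {n : ℕ} {f : MvPolynomial (Fin (n + 1)) K}

/-- Laplace expansion along the last row, which is the gradient of `f`. The complementary minors,
expanded multilinearly in their rows, are the determinants defining `quadBracket`. -/
theorem polyBracket_eq_jac (hf : f.IsHomogeneous 2) (a : Fin n → MvPolynomial (Fin (n + 1)) K) :
    polyBracket f a = jac (Fin.snoc a f : Fin (n + 1) → MvPolynomial (Fin (n + 1)) K) := by
  have minor : ∀ p : Fin (n + 1), (Matrix.of fun k l => pderiv (p.succAbove l) (a k)).det =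
      ∑ i : Fin n → Fin (n + 1), (∏ k, pderiv (i k) (a k)) * C (Matrix.of fun k l =>
        Pi.basisFun K (Fin (n + 1)) (i k) (p.succAbove l)).det := by
    intro p
    have h : (Matrix.of fun k l => pderiv (p.succAbove l) (a k) : Matrix (Fin n) (Fin n) _) =
        fun k => ∑ i, pderiv i (a k) • fun l => if p.succAbove l = i then 1 else 0 := by
      funext k l
      simp [Finset.sum_apply]
    rw [h]
    refine (Matrix.detRowAlternating.toMultilinearMap.map_sum _).trans
      (Finset.sum_congr rfl fun i _ => ?_)
    refine (Matrix.detRowAlternating.map_smul_univ _ _).trans ?_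
    rw [smul_eq_mul, RingHom.map_det]
    congr 1
    change Matrix.det _ = _
    congr 1
    ext k l
    simp [Pi.single_apply, apply_ite C]
  rw [polyBracket, envelopingBracket_apply, jac, Matrix.det_succ_row _ (Fin.last n)]
  simp_rw [quadBracket_apply, map_sum, map_smul, linForm_gradVec hf, Finset.mul_sum]
  rw [Finset.sum_comm]
  refine Finset.sum_congr rfl fun p _ => ?_
  have hsub : (Matrix.of fun k l => pderiv l ((Fin.snoc a f :
      Fin (n + 1) → MvPolynomial (Fin (n + 1)) K) k)).submatrix (Fin.last n).succAbove p.succAbove =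
      Matrix.of fun k l => pderiv (p.succAbove l) (a k) := by
    ext k l
    simp
  have hs : ((-1 : K) ^ (n - (p : ℕ))) = (-1) ^ (n + (p : ℕ)) := by
    have : n + (p : ℕ) = (n - p) + 2 * p := by have := p.is_le; omega
    rw [this, pow_add, pow_mul]
    simp
  rw [hsub, minor, Finset.mul_sum]
  refine Finset.sum_congr rfl fun i _ => ?_
  simp only [hs, smul_eq_C_mul, Fin.val_last, Matrix.of_apply, Fin.snoc_last, map_pow, map_neg,
    map_one]
  ring

theorem polyBracket_update (hf : f.IsHomogeneous 2) (v : Fin n → MvPolynomial (Fin (n + 1)) K)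
    (j : Fin n) (x : MvPolynomial (Fin (n + 1)) K) :
    polyBracket f (Function.update v j x) = jac (Function.update
      (Fin.snoc v f : Fin (n + 1) → MvPolynomial (Fin (n + 1)) K) j.castSucc x) := by
  rw [polyBracket_eq_jac hf, Fin.snoc_update]

theorem jac_update_snoc_self (v : Fin n → MvPolynomial (Fin (n + 1)) K) (j : Fin n) :
    jac (Function.update (Fin.snoc v f : Fin (n + 1) → MvPolynomial (Fin (n + 1)) K)
      j.castSucc f) = 0 := by
  refine jac_eq_zero_of_eq _ (Fin.castSucc_ne_last j) ?_
  rw [Function.update_self, Function.update_of_ne (Fin.castSucc_ne_last j).symm, Fin.snoc_last]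

theorem polyBracket_isNLie [CharZero K] (hf : f.IsHomogeneous 2) : IsNLie (polyBracket f) := by
  intro j u v
  simp only [polyBracket_update hf, polyBracket_eq_jac hf]
  rw [jac_update_jac, Fin.sum_univ_castSucc]
  simp only [Fin.snoc_castSucc, Fin.snoc_last]
  -- The extra term differentiates the fixed last argument `f`; it vanishes because two rows of the
  -- inner Jacobian coincide.
  rw [jac_update_snoc_self, ← jacDerivation_apply _ (Fin.last n), map_zero, add_zero]

theorem polyBracket_isNLiePoisson [CharZero K] (hf : f.IsHomogeneous 2) :
    IsNLiePoisson (polyBracket f) :=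
  ⟨polyBracket_isNLie hf, envelopingBracket_isLeibniz _ _⟩

theorem quadBracket_isNLie [CharZero K] (hf : f.IsHomogeneous 2) : IsNLie (quadBracket f) := by
  intro j u v
  apply linForm_injective
  have hu : ∀ (w : Fin n → Fin (n + 1) → K) (i : Fin n) (x : Fin (n + 1) → K),
      (fun k => linForm (Pi.basisFun K (Fin (n + 1))) (Function.update w i x k)) =
        Function.update (fun k => linForm (Pi.basisFun K (Fin (n + 1))) (w k)) i
          (linForm (Pi.basisFun K (Fin (n + 1))) x) := fun w i x =>
    Function.comp_update _ w i x
  simp only [map_sum, linForm_quadBracket, hu]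
  exact polyBracket_isNLie hf j _ _

/-- A multiple of `f - c` in one argument makes the bracket a multiple of `f - c`. -/
theorem isPoissonIdeal_span_sub_C (hf : f.IsHomogeneous 2) (c : K) :
    IsPoissonIdeal (polyBracket f) (Ideal.span {f - C c}) := by
  intro v i hv
  obtain ⟨g, hg⟩ := Ideal.mem_span_singleton'.1 hv
  rw [← Function.update_eq_self i v, ← hg, polyBracket_update hf, ← jacDerivation_apply,
    Derivation.leibniz]
  have h0 : jacDerivation (Fin.snoc v f : Fin (n + 1) → MvPolynomial (Fin (n + 1)) K) i.castSucc
      (f - C c) = 0 := by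
    rw [map_sub, jacDerivation_apply, jac_update_snoc_self]
    have : (C c : MvPolynomial (Fin (n + 1)) K) = algebraMap K _ c := rfl
    rw [this, Derivation.map_algebraMap, sub_zero]
  rw [h0, smul_zero, zero_add, smul_eq_mul]
  exact Ideal.mul_mem_right _ _ (Ideal.mem_span_singleton_self _)

/-- The bracket with `p` and `n - 1` of the variables `X k`. -/
theorem exists_polyBracket_eq (hf : f.IsHomogeneous 2) {a b : Fin (n + 1)} (hab : a ≠ b) :
    ∃ (s : ℤˣ) (i : Fin n) (τ : Fin n → Fin (n + 1)),
      ∀ p, polyBracket f (Function.update (fun k => X (τ k)) i p) =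
        ((s : ℤ) : MvPolynomial (Fin (n + 1)) K) *
          (pderiv a p * pderiv b f - pderiv b p * pderiv a f) := by
  -- This permutation moves `f` from the last place to place `b`; its sign is `s`.
  set π : Equiv.Perm (Fin (n + 1)) := Equiv.swap (Fin.last n) b with hπ
  have hlast : π (Fin.last n) = b := by simp [hπ]
  have hne : π⁻¹ a ≠ Fin.last n := by
    intro h
    rw [Equiv.Perm.inv_eq_iff_eq, hlast] at h
    exact hab h
  obtain ⟨i, hi⟩ := Fin.exists_castSucc_eq.2 hne
  have hia : π i.castSucc = a := by rw [hi]; simp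
  refine ⟨Equiv.Perm.sign π, i, fun k => π k.castSucc, fun p => ?_⟩
  rw [polyBracket_eq_jac hf, ← jac_X_update_update hab, ← jac_comp_perm]
  congr 1
  funext k
  refine Fin.lastCases ?_ (fun k => ?_) k
  · simp [hlast]
  · have hkb : π k.castSucc ≠ b := by
      rw [← hlast]
      exact fun h => Fin.castSucc_ne_last k (π.injective h)
    rw [Fin.snoc_castSucc, Function.comp_apply, Function.update_of_ne hkb]
    rcases eq_or_ne k i with rfl | hki
    · simp [hia]
    · have : π k.castSucc ≠ a := by
        rw [← hia]
        exact fun h => hki (Fin.castSucc_injective _ (π.injective h))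
      rw [Function.update_of_ne this, Function.update_of_ne hki]

theorem IsPoissonIdeal.pderiv_mul_sub_mem (hf : f.IsHomogeneous 2)
    {I : Ideal (MvPolynomial (Fin (n + 1)) K)} {p : MvPolynomial (Fin (n + 1)) K}
    (hp : ∀ (v : Fin n → MvPolynomial (Fin (n + 1)) K) (i : Fin n),
      polyBracket f (Function.update v i p) ∈ I) (a b : Fin (n + 1)) :
    pderiv a f * pderiv b p - pderiv b f * pderiv a p ∈ I := by
  rcases eq_or_ne a b with rfl | hab
  · simp
  obtain ⟨s, i, τ, h⟩ := exists_polyBracket_eq hf hab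
  have h1 := I.mul_mem_left (-((s : ℤ) : MvPolynomial (Fin (n + 1)) K))
    (hp (fun k => X (τ k)) i)
  rw [h, ← mul_assoc, neg_mul, ← Int.cast_mul, ← Units.val_mul, Int.units_mul_self] at h1
  convert h1 using 1
  simp
  ring

end PolyBracket

/-! ### The Hessian and simplicity of `𝕃(f)`. -/

section Hessian

variable {K : Type*} [Field K] {n : ℕ} {f : MvPolynomial (Fin (n + 1)) K}

/-- The matrix of the polar form of the quadratic form `f`. -/
noncomputable def hessian (f : MvPolynomial (Fin (n + 1)) K) :
    Matrix (Fin (n + 1)) (Fin (n + 1)) K :=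
  Matrix.of (gradVec f)

theorem pderiv_pderiv_quad (hf : f.IsHomogeneous 2) (i j : Fin (n + 1)) :
    pderiv j (pderiv i f) = C (hessian f i j) := by
  rw [← linForm_gradVec hf, pderiv_linForm]
  rfl

theorem pderiv_quad (hf : f.IsHomogeneous 2) (i : Fin (n + 1)) :
    pderiv i f = ∑ j, C (hessian f i j) * X j := by
  rw [← linForm_gradVec hf, linForm_basisFun]
  rfl

theorem hessian_comm (hf : f.IsHomogeneous 2) (i j : Fin (n + 1)) :
    hessian f i j = hessian f j i := by
  apply C_injective (Fin (n + 1)) K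
  rw [← pderiv_pderiv_quad hf, ← pderiv_pderiv_quad hf, pderiv_comm]

theorem sum_X_mul_pderiv_quad (hf : f.IsHomogeneous 2) :
    ∑ i, X i * pderiv i f = 2 * f := by
  rw [hf.sum_X_mul_pderiv, two_nsmul, two_mul]

theorem two_mul_eval_quad (hf : f.IsHomogeneous 2) (z : Fin (n + 1) → K) :
    2 * eval z f = ∑ i, ∑ j, z i * (hessian f i j * z j) := by
  have h := congrArg (eval z) (sum_X_mul_pderiv_quad hf)
  simp only [map_mul, map_sum, eval_X, map_ofNat, pderiv_quad hf, eval_C, Finset.mul_sum] at h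
  exact h.symm

theorem polar_eval [CharZero K] (hf : f.IsHomogeneous 2) (x y : Fin (n + 1) → K) :
    QuadraticMap.polar (fun z => eval z f) x y = ∑ i, y i * ∑ j, hessian f i j * x j := by
  apply mul_left_cancel₀ (two_ne_zero' K)
  rw [QuadraticMap.polar, mul_sub, mul_sub, two_mul_eval_quad hf, two_mul_eval_quad hf,
    two_mul_eval_quad hf, two_mul]
  have h : ∑ i, y i * ∑ j, hessian f i j * x j = ∑ i, ∑ j, x i * (hessian f i j * y j) := by
    simp_rw [Finset.mul_sum]
    rw [Finset.sum_comm]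
    refine Finset.sum_congr rfl fun i _ => Finset.sum_congr rfl fun j _ => ?_
    rw [hessian_comm hf]
    ring
  conv_rhs => enter [1]; rw [h]
  simp_rw [Finset.mul_sum, ← Finset.sum_sub_distrib, ← Finset.sum_add_distrib]
  refine Finset.sum_congr rfl fun i _ => Finset.sum_congr rfl fun j _ => ?_
  simp only [Pi.add_apply]
  ring

theorem det_hessian_ne_zero [CharZero K] (hf : f.IsHomogeneous 2) (hnd : IsNondegenerate f) :
    (hessian f).det ≠ 0 := by
  intro h
  obtain ⟨v, hv, h0⟩ := Matrix.exists_mulVec_eq_zero_iff.2 h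
  refine hv (hnd v fun y => ?_)
  rw [polar_eval hf]
  refine Finset.sum_eq_zero fun i _ => ?_
  have : ∑ j, hessian f i j * v j = 0 := congrFun h0 i
  rw [this, mul_zero]

theorem smul_gradVec_sub_mem (hf : f.IsHomogeneous 2) {I : Submodule K (Fin (n + 1) → K)}
    (hI : ∀ (v : Fin n → Fin (n + 1) → K) (i : Fin n), v i ∈ I → quadBracket f v ∈ I)
    {v : Fin (n + 1) → K} (hv : v ∈ I) (a b : Fin (n + 1)) :
    v a • gradVec f b - v b • gradVec f a ∈ I := by
  rcases eq_or_ne a b with rfl | hab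
  · simp
  obtain ⟨s, i, τ, h⟩ := exists_polyBracket_eq hf hab
  have h1 := hI (Function.update (fun k => (Pi.single (τ k) 1 : Fin (n + 1) → K)) i v) i (by simpa using hv)
  have h2 : quadBracket f (Function.update (fun k => (Pi.single (τ k) 1 : Fin (n + 1) → K)) i v) =
      ((s : ℤ) : K) • (v a • gradVec f b - v b • gradVec f a) := by
    apply linForm_injective
    have hX : (fun k => linForm (Pi.basisFun K (Fin (n + 1)))
        (Function.update (fun k => (Pi.single (τ k) 1 : Fin (n + 1) → K)) i v k)) =
        Function.update (fun k => X (τ k)) i (linForm (Pi.basisFun K (Fin (n + 1))) v) := by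
      funext k
      rcases eq_or_ne k i with rfl | hk
      · simp
      · simp [hk, linForm_basisFun, Pi.single_apply, apply_ite C]
    rw [linForm_quadBracket, hX]
    refine (h _).trans ?_
    simp only [pderiv_linForm, map_smul, map_sub, linForm_gradVec hf, smul_eq_C_mul, map_intCast]
  rw [h2] at h1
  have h3 := I.smul_mem ((s : ℤ) : K) h1
  rwa [smul_smul, ← Int.cast_mul, ← Units.val_mul, Int.units_mul_self, Units.val_one,
    Int.cast_one, one_smul] at h3

theorem quadBracket_isSimple [CharZero K] (hn : 2 ≤ n) (hf : f.IsHomogeneous 2)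
    (hnd : IsNondegenerate f) : IsSimpleNAry (quadBracket f) := by
  have hdet : IsUnit (hessian f).det := (det_hessian_ne_zero hf hnd).isUnit
  have hli : LinearIndependent K (gradVec f) := by
    have := Matrix.linearIndependent_rows_of_isUnit ((Matrix.isUnit_iff_isUnit_det _).2 hdet)
    exact this
  have hsurj : ∀ x : Fin (n + 1) → K, ∃ c : Fin (n + 1) → K, ∑ b, c b • gradVec f b = x := by
    intro x
    refine ⟨Matrix.vecMul x (hessian f)⁻¹, ?_⟩
    have h : Matrix.vecMul (Matrix.vecMul x (hessian f)⁻¹) (hessian f) = x := by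
      rw [Matrix.vecMul_vecMul, Matrix.nonsing_inv_mul _ hdet, Matrix.vecMul_one]
    rw [Matrix.vecMul_eq_sum] at h
    exact h
  refine ⟨fun h0 => ?_, fun I hI => ?_⟩
  · have h1 := quadBracket_basis f 0
    rw [h0, AlternatingMap.zero_apply] at h1
    exact hli.ne_zero 0 (((smul_eq_zero_iff_right (by simp)).1 h1.symm))
  rw [or_iff_not_imp_left]
  intro hbot
  obtain ⟨v, hv, hv0⟩ := I.exists_mem_ne_zero_of_ne_bot hbot
  -- Each nonzero element of `I` puts a whole hyperplane into `I`.
  have key : ∀ v ∈ I, v ≠ 0 → ∀ c : Fin (n + 1) → K, ∑ b, c b * v b = 0 →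
      ∑ b, c b • gradVec f b ∈ I := by
    intro v hv hv0 c hc
    obtain ⟨a, ha⟩ := Function.ne_iff.1 hv0
    have h1 : ∑ b, c b • (v a • gradVec f b - v b • gradVec f a) =
        v a • ∑ b, c b • gradVec f b := by
      simp_rw [smul_sub, Finset.sum_sub_distrib, smul_smul, ← Finset.sum_smul, hc, zero_smul,
        sub_zero, Finset.smul_sum, smul_smul, mul_comm]
    have h2 : v a • ∑ b, c b • gradVec f b ∈ I := by
      rw [← h1]
      exact I.sum_mem fun b _ => I.smul_mem _ (smul_gradVec_sub_mem hf hI hv a b)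
    exact (I.smul_mem_iff ha).1 h2
  -- Two independent elements exist: otherwise `I` is the line of `v`, yet for three distinct
  -- indices `a, b, b'` (here `n ≥ 2` enters) it contains the independent vectors `w b` and `w b'`.
  obtain ⟨u, hu, p, q, hpq⟩ : ∃ u ∈ I, ∃ p q, u q * v p - u p * v q ≠ 0 := by
    by_contra! hall
    obtain ⟨a, ha⟩ := Function.ne_iff.1 hv0
    have ha' : v a ≠ 0 := ha
    have hprop : ∀ u ∈ I, v a • u = u a • v := by
      intro u hu
      funext b
      have := hall u hu a b
      simp only [Pi.smul_apply, smul_eq_mul]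
      linear_combination this
    obtain ⟨b, hb⟩ : ∃ b, b ≠ a := by
      have : Nontrivial (Fin (n + 1)) := Fin.nontrivial_iff_two_le.2 (by omega)
      exact exists_ne a
    obtain ⟨b', hb'⟩ : ∃ b', b' ∉ ({a, b} : Finset (Fin (n + 1))) := by
      by_contra! hcov
      have h1 := Finset.card_le_card (fun x _ => hcov x : Finset.univ ⊆ {a, b})
      have h2 := Finset.card_le_two (a := a) (b := b)
      rw [Finset.card_univ, Fintype.card_fin] at h1
      omega
    simp only [Finset.mem_insert, Finset.mem_singleton, not_or] at hb'
    obtain ⟨hb'a, hb'b⟩ := hb'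
    have hmem := fun b => smul_gradVec_sub_mem hf hI hv a b
    set w : Fin (n + 1) → Fin (n + 1) → K := fun b => v a • gradVec f b - v b • gradVec f a with hw
    have hdep : w b' a • w b - w b a • w b' = 0 := by
      have h1 := hprop _ (hmem b)
      have h2 := hprop _ (hmem b')
      apply (smul_eq_zero_iff_right ha').1
      change v a • w b = w b a • v at h1
      change v a • w b' = w b' a • v at h2
      rw [smul_sub, smul_comm, smul_comm (v a) (w b a), h1, h2, smul_comm, sub_self]
    have hcoef : ∀ s t : K, s • w b - t • w b' = 0 → s = 0 ∧ t = 0 := by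
      intro s t hst
      have hsum : ∑ k, (Pi.single b (s * v a) - Pi.single b' (t * v a) -
          Pi.single a (s * v b - t * v b') : Fin (n + 1) → K) k • gradVec f k = 0 := by
        simp only [Pi.sub_apply, sub_smul, Finset.sum_sub_distrib, Pi.single_apply, ite_smul,
          zero_smul, Finset.sum_ite_eq', Finset.mem_univ, if_true]
        rw [← hst, hw]
        module
      have h := Fintype.linearIndependent_iff.1 hli _ hsum
      exact ⟨by simpa [hb, Ne.symm hb'b, ha'] using h b, by simpa [hb'a, hb'b, ha'] using h b'⟩
    have h2 : w b' = 0 := by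
      have : v a • w b' = w b' a • v := hprop _ (hmem b')
      rw [(hcoef _ _ hdep).1, zero_smul] at this
      exact (smul_eq_zero_iff_right ha').1 this
    exact one_ne_zero (hcoef 0 1 (by rw [h2]; simp)).2
  have hu0 : u ≠ 0 := by
    rintro rfl
    simp at hpq
  rw [eq_top_iff]
  intro x _
  obtain ⟨c, rfl⟩ := hsurj x
  -- The vector `d` is chosen with `d · u = 0` and `d · v = c · v`, so `c = d + (c - d)` splits
  -- between the two hyperplanes.
  set t := (∑ b, c b * v b) / (u q * v p - u p * v q) with ht
  set d : Fin (n + 1) → K := Pi.single p (t * u q) - Pi.single q (t * u p) with hd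
  have hdot : ∀ w : Fin (n + 1) → K, ∑ b, d b * w b = t * (u q * w p - u p * w q) := by
    intro w
    simp only [hd, Pi.sub_apply, sub_mul, Finset.sum_sub_distrib, Pi.single_apply, ite_mul,
      zero_mul, Finset.sum_ite_eq', Finset.mem_univ, if_true]
    ring
  have h1 := key u hu hu0 d (by rw [hdot]; ring)
  have h2 := key v hv hv0 (c - d) (by
    simp only [Pi.sub_apply, sub_mul, Finset.sum_sub_distrib, hdot]
    rw [ht, div_mul_cancel₀ _ hpq, sub_self])
  have h3 := I.add_mem h1 h2
  rw [← Finset.sum_add_distrib] at h3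
  simpa [sub_smul] using h3

end Hessian

/-! ### Laplacian, rotations and the Casimir element. -/

section Harmonic

variable {K : Type*} [Field K] {n : ℕ} {f : MvPolynomial (Fin (n + 1)) K}

/-- The derivation `∂ⁱ` obtained from the partial derivatives by raising the index with the
inverse of the matrix of `f`. -/
noncomputable def raisedPderiv (f : MvPolynomial (Fin (n + 1)) K) (i : Fin (n + 1)) :
    Derivation K (MvPolynomial (Fin (n + 1)) K) (MvPolynomial (Fin (n + 1)) K) :=
  mkDerivation K fun k => C ((hessian f)⁻¹ i k)

theorem raisedPderiv_X (i k : Fin (n + 1)) :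
    raisedPderiv f i (X k) = C ((hessian f)⁻¹ i k) :=
  mkDerivation_X _ _ _

theorem raisedPderiv_apply (i : Fin (n + 1)) (p : MvPolynomial (Fin (n + 1)) K) :
    raisedPderiv f i p = ∑ k, C ((hessian f)⁻¹ i k) * pderiv k p := by
  rw [derivation_eq_sum_pderiv]
  simp only [raisedPderiv_X, mul_comm]

theorem pderiv_raisedPderiv (i j : Fin (n + 1)) (p : MvPolynomial (Fin (n + 1)) K) :
    pderiv i (raisedPderiv f j p) = raisedPderiv f j (pderiv i p) := by
  apply derivation_comm_of_X
  intro k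
  rw [raisedPderiv_X, pderiv_C, pderiv_X, Pi.single_apply]
  split_ifs <;> simp

theorem isHomogeneous_raisedPderiv {d : ℕ} {p : MvPolynomial (Fin (n + 1)) K}
    (hp : p.IsHomogeneous d) (i : Fin (n + 1)) : (raisedPderiv f i p).IsHomogeneous (d - 1) := by
  rw [raisedPderiv_apply]
  refine IsHomogeneous.sum _ _ _ fun k _ => ?_
  simpa using (isHomogeneous_C _ ((hessian f)⁻¹ i k)).mul (hp.pderiv (i := k))

theorem inv_hessian_comm (hf : f.IsHomogeneous 2) (i j : Fin (n + 1)) :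
    (hessian f)⁻¹ i j = (hessian f)⁻¹ j i := by
  have h : (hessian f).transpose = hessian f := by
    ext i j
    exact hessian_comm hf j i
  have h2 := Matrix.transpose_nonsing_inv (hessian f)
  rw [h] at h2
  exact congrFun (congrFun h2 j) i

theorem sum_inv_hessian_mul (hd : (hessian f).det ≠ 0) (i j : Fin (n + 1)) :
    ∑ k, (hessian f)⁻¹ i k * hessian f k j = if i = j then 1 else 0 := by
  rw [← Matrix.mul_apply, Matrix.nonsing_inv_mul _ hd.isUnit, Matrix.one_apply]

theorem raisedPderiv_quad (hf : f.IsHomogeneous 2) (hd : (hessian f).det ≠ 0) (i : Fin (n + 1)) :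
    raisedPderiv f i f = X i := by
  simp_rw [raisedPderiv_apply, pderiv_quad hf, Finset.mul_sum]
  rw [Finset.sum_comm]
  simp_rw [← mul_assoc, ← C_mul, ← Finset.sum_mul, ← map_sum, sum_inv_hessian_mul hd]
  simp [apply_ite C]

theorem raisedPderiv_pderiv_quad (hf : f.IsHomogeneous 2) (hd : (hessian f).det ≠ 0)
    (i j : Fin (n + 1)) : raisedPderiv f i (pderiv j f) = if i = j then 1 else 0 := by
  rw [← pderiv_raisedPderiv, raisedPderiv_quad hf hd, pderiv_X, Pi.single_apply]

theorem sum_pderiv_mul_inv_hessian (hf : f.IsHomogeneous 2) (hd : (hessian f).det ≠ 0)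
    (i : Fin (n + 1)) : ∑ j, pderiv j f * C ((hessian f)⁻¹ i j) = X i := by
  rw [← raisedPderiv_quad hf hd i, raisedPderiv_apply]
  exact Finset.sum_congr rfl fun j _ => mul_comm _ _

theorem sum_X_mul_hessian (hf : f.IsHomogeneous 2) (j : Fin (n + 1)) :
    ∑ i, X i * C (hessian f i j) = pderiv j f := by
  rw [pderiv_quad hf]
  exact Finset.sum_congr rfl fun i _ => by rw [hessian_comm hf, mul_comm]

theorem sum_hessian_mul_raisedPderiv (hd : (hessian f).det ≠ 0) (j : Fin (n + 1))
    (p : MvPolynomial (Fin (n + 1)) K) :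
    ∑ i, C (hessian f j i) * raisedPderiv f i p = pderiv j p := by
  simp_rw [raisedPderiv_apply, Finset.mul_sum]
  rw [Finset.sum_comm]
  simp_rw [← mul_assoc, ← C_mul, ← Finset.sum_mul, ← map_sum, ← Matrix.mul_apply,
    Matrix.mul_nonsing_inv _ hd.isUnit, Matrix.one_apply]
  simp [apply_ite C]

variable {d : ℕ} {p : MvPolynomial (Fin (n + 1)) K}

theorem sum_X_mul_pderiv (hp : p.IsHomogeneous d) :
    ∑ i, X i * pderiv i p = (d : MvPolynomial (Fin (n + 1)) K) * p := by
  rw [hp.sum_X_mul_pderiv, nsmul_eq_mul]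

theorem sum_pderiv_mul_raisedPderiv (hf : f.IsHomogeneous 2) (hd : (hessian f).det ≠ 0)
    (hp : p.IsHomogeneous d) :
    ∑ i, pderiv i f * raisedPderiv f i p = (d : MvPolynomial (Fin (n + 1)) K) * p := by
  rw [← sum_X_mul_pderiv hp]
  simp_rw [raisedPderiv_apply, Finset.mul_sum]
  rw [Finset.sum_comm]
  refine Finset.sum_congr rfl fun k _ => ?_
  rw [← sum_pderiv_mul_inv_hessian hf hd k, Finset.sum_mul]
  refine Finset.sum_congr rfl fun i _ => ?_
  rw [inv_hessian_comm hf, mul_assoc]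

/-- The Laplace operator of the quadratic form `f`. -/
noncomputable def laplacian (f : MvPolynomial (Fin (n + 1)) K) :
    MvPolynomial (Fin (n + 1)) K →ₗ[K] MvPolynomial (Fin (n + 1)) K :=
  ∑ i, (pderiv i).toLinearMap ∘ₗ (raisedPderiv f i).toLinearMap

theorem laplacian_apply (p : MvPolynomial (Fin (n + 1)) K) :
    laplacian f p = ∑ i, pderiv i (raisedPderiv f i p) := by
  simp [laplacian, LinearMap.sum_apply]

theorem isHomogeneous_laplacian (hp : p.IsHomogeneous d) :
    (laplacian f p).IsHomogeneous (d - 2) := by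
  rw [laplacian_apply]
  exact IsHomogeneous.sum _ _ _ fun i _ => (isHomogeneous_raisedPderiv hp i).pderiv

/-- Product rule with `∂ⁱ f = Xᵢ`: the Laplacian of `f` is `n + 1`, and the two cross terms each
give `d * p` by Euler's identity. -/
theorem laplacian_quad_mul (hf : f.IsHomogeneous 2) (hd : (hessian f).det ≠ 0)
    (hp : p.IsHomogeneous d) :
    laplacian f (f * p) = ((n + 1 + 2 * d : ℕ) : MvPolynomial (Fin (n + 1)) K) * p +
      f * laplacian f p := by
  have h : ∀ i, pderiv i (raisedPderiv f i (f * p)) = p + X i * pderiv i p +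
      pderiv i f * raisedPderiv f i p + f * pderiv i (raisedPderiv f i p) := by
    intro i
    rw [Derivation.leibniz, raisedPderiv_quad hf hd, map_add, smul_eq_mul, smul_eq_mul,
      Derivation.leibniz, Derivation.leibniz, pderiv_X_self]
    simp only [smul_eq_mul]
    ring
  simp_rw [laplacian_apply, h, Finset.sum_add_distrib, sum_X_mul_pderiv hp,
    sum_pderiv_mul_raisedPderiv hf hd hp, Finset.mul_sum]
  simp
  ring

/-- The infinitesimal rotation `Xᵢ ∂ⱼ - (∂f/∂xⱼ) ∂ⁱ`, which annihilates `f`. -/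
noncomputable def rotation (f : MvPolynomial (Fin (n + 1)) K) (i j : Fin (n + 1))
    (p : MvPolynomial (Fin (n + 1)) K) : MvPolynomial (Fin (n + 1)) K :=
  X i * pderiv j p - pderiv j f * raisedPderiv f i p

theorem rotation_eq (hf : f.IsHomogeneous 2) (hd : (hessian f).det ≠ 0) (i j : Fin (n + 1)) :
    rotation f i j p =
      ∑ k, C ((hessian f)⁻¹ i k) * (pderiv k f * pderiv j p - pderiv j f * pderiv k p) := by
  rw [rotation, ← sum_pderiv_mul_inv_hessian hf hd i, raisedPderiv_apply, Finset.sum_mul,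
    Finset.mul_sum, ← Finset.sum_sub_distrib]
  refine Finset.sum_congr rfl fun k _ => ?_
  ring

/-- The Casimir element of the rotations. -/
noncomputable def casimir (f : MvPolynomial (Fin (n + 1)) K)
    (p : MvPolynomial (Fin (n + 1)) K) : MvPolynomial (Fin (n + 1)) K :=
  ∑ i, ∑ j, rotation f i j (rotation f j i p)

theorem rotation_rotation (hf : f.IsHomogeneous 2) (hd : (hessian f).det ≠ 0)
    (i j : Fin (n + 1)) : rotation f i j (rotation f j i p) =
      X i * pderiv i p + X i * (X j * pderiv j (pderiv i p))
      - X i * C (hessian f i j) * raisedPderiv f j p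
      - X i * pderiv i f * pderiv j (raisedPderiv f j p)
      - pderiv j f * C ((hessian f)⁻¹ i j) * pderiv i p
      - X j * pderiv j f * pderiv i (raisedPderiv f i p)
      + pderiv j f * raisedPderiv f j p
      + pderiv j f * (pderiv i f * raisedPderiv f i (raisedPderiv f j p)) := by
  simp only [rotation, map_sub, Derivation.leibniz, smul_eq_mul, pderiv_X_self, raisedPderiv_X,
    pderiv_pderiv_quad hf, raisedPderiv_pderiv_quad hf hd, if_true, pderiv_raisedPderiv]
  ring

/-- The eight terms of `rotation_rotation` are summed by Euler's identity and its raised version.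
Truncation in `d - 1` is harmless, as that factor always comes with `d`. -/
theorem casimir_eq (hf : f.IsHomogeneous 2) (hd : (hessian f).det ≠ 0) (hp : p.IsHomogeneous d) :
    casimir f p = ((2 * (d * (d - 1) + n * d) : ℕ) : MvPolynomial (Fin (n + 1)) K) * p -
      4 * f * laplacian f p := by
  have hX := sum_X_mul_pderiv_quad hf
  have h1 : ∑ i, X i * pderiv i p = (d : MvPolynomial (Fin (n + 1)) K) * p := sum_X_mul_pderiv hp
  have h2 := sum_pderiv_mul_raisedPderiv hf hd hp
  have h3 : ∑ i, X i * ∑ j, X j * pderiv j (pderiv i p) =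
      ((d - 1 : ℕ) : MvPolynomial (Fin (n + 1)) K) *
        ((d : MvPolynomial (Fin (n + 1)) K) * p) := by
    rw [← h1, Finset.mul_sum]
    refine Finset.sum_congr rfl fun i _ => ?_
    rw [sum_X_mul_pderiv hp.pderiv]
    ring
  have h4 : ∑ j, pderiv j f * ∑ i, pderiv i f * raisedPderiv f i (raisedPderiv f j p) =
      ((d - 1 : ℕ) : MvPolynomial (Fin (n + 1)) K) *
        ((d : MvPolynomial (Fin (n + 1)) K) * p) := by
    rw [← h2, Finset.mul_sum]
    refine Finset.sum_congr rfl fun j _ => ?_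
    rw [sum_pderiv_mul_raisedPderiv hf hd (isHomogeneous_raisedPderiv hp j)]
    ring
  have h5 : ∑ i, ∑ j, X i * C (hessian f i j) * raisedPderiv f j p =
      (d : MvPolynomial (Fin (n + 1)) K) * p := by
    rw [Finset.sum_comm, ← h2]
    refine Finset.sum_congr rfl fun j _ => ?_
    rw [← Finset.sum_mul, sum_X_mul_hessian hf]
  have h6 : ∑ i, ∑ j, pderiv j f * C ((hessian f)⁻¹ i j) * pderiv i p =
      (d : MvPolynomial (Fin (n + 1)) K) * p := by
    rw [← h1]
    refine Finset.sum_congr rfl fun i _ => ?_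
    rw [← Finset.sum_mul, sum_pderiv_mul_inv_hessian hf hd]
  have h7 : ∑ i, ∑ j, X i * pderiv i f * pderiv j (raisedPderiv f j p) =
      2 * f * laplacian f p := by
    rw [laplacian_apply, ← hX, Finset.sum_mul_sum]
  have h8 : ∑ i, ∑ j, X j * pderiv j f * pderiv i (raisedPderiv f i p) =
      2 * f * laplacian f p := by
    rw [Finset.sum_comm, laplacian_apply, ← hX, Finset.sum_mul_sum]
  have h9 : ∑ i, ∑ j, pderiv j f * (pderiv i f * raisedPderiv f i (raisedPderiv f j p)) =
      ((d - 1 : ℕ) : MvPolynomial (Fin (n + 1)) K) *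
        ((d : MvPolynomial (Fin (n + 1)) K) * p) := by
    rw [Finset.sum_comm, ← h4]
    simp_rw [Finset.mul_sum]
  simp_rw [Finset.mul_sum] at h3
  simp_rw [casimir, rotation_rotation hf hd, Finset.sum_add_distrib, Finset.sum_sub_distrib,
    Finset.sum_add_distrib]
  rw [h3, h5, h6, h7, h8, h9, h2]
  simp_rw [Finset.sum_const, ← Finset.smul_sum, h1]
  simp only [Finset.card_univ, Fintype.card_fin, nsmul_eq_mul]
  push_cast
  ring

end Harmonic

/-! ### Harmonic decomposition and separation of degrees. -/

section Decomposition

variable {K : Type*} [Field K] {n : ℕ} {f : MvPolynomial (Fin (n + 1)) K}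

/-- `h` is a harmonic polynomial, homogeneous of degree `d`. -/
def IsHarmonic (f : MvPolynomial (Fin (n + 1)) K) (d : ℕ) (h : MvPolynomial (Fin (n + 1)) K) :
    Prop :=
  h.IsHomogeneous d ∧ laplacian f h = 0

/-- The constant is `(k + 1)(n + 1 + 2e + 2k)`; only its being nonzero matters, since characteristic
zero then permits inverting the Laplacian on these products. -/
theorem laplacian_quad_pow_mul (hf : f.IsHomogeneous 2) (hd : (hessian f).det ≠ 0) {e : ℕ}
    {h : MvPolynomial (Fin (n + 1)) K} (hh : IsHarmonic f e h) (k : ℕ) :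
    ∃ a : ℕ, a ≠ 0 ∧ laplacian f (f ^ (k + 1) * h) = (a : MvPolynomial (Fin (n + 1)) K) *
      (f ^ k * h) := by
  induction k with
  | zero =>
    refine ⟨n + 1 + 2 * e, by omega, ?_⟩
    rw [zero_add, pow_one, laplacian_quad_mul hf hd hh.1, hh.2]
    simp
  | succ k ih =>
    obtain ⟨a, ha, h1⟩ := ih
    refine ⟨n + 1 + 2 * (2 * (k + 1) + e) + a, by omega, ?_⟩
    rw [pow_succ' f (k + 1), mul_assoc, laplacian_quad_mul hf hd ((hf.pow (k + 1)).mul hh.1), h1]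
    push_cast
    ring

/-- The span of the products `f ^ k * h` of degree `d` with `h` harmonic. -/
noncomputable def harmonicProducts (f : MvPolynomial (Fin (n + 1)) K) (d : ℕ) :
    Submodule K (MvPolynomial (Fin (n + 1)) K) :=
  Submodule.span K {p | ∃ (k e : ℕ) (h : MvPolynomial (Fin (n + 1)) K),
    IsHarmonic f e h ∧ 2 * k + e = d ∧ p = f ^ k * h}

theorem exists_laplacian_eq [CharZero K] (hf : f.IsHomogeneous 2) (hd : (hessian f).det ≠ 0) {d : ℕ}
    {r : MvPolynomial (Fin (n + 1)) K} (hr : r ∈ harmonicProducts f d) :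
    ∃ q ∈ harmonicProducts f (d + 2), q.IsHomogeneous (d + 2) ∧ laplacian f q = r := by
  induction hr using Submodule.span_induction with
  | mem r hr =>
    obtain ⟨k, e, h, hh, hke, rfl⟩ := hr
    obtain ⟨a, ha, h1⟩ := laplacian_quad_pow_mul hf hd hh k
    have hdeg : 2 * (k + 1) + e = d + 2 := by omega
    refine ⟨(a : K)⁻¹ • (f ^ (k + 1) * h), Submodule.smul_mem _ _
      (Submodule.subset_span ⟨k + 1, e, h, hh, hdeg, rfl⟩), ?_, ?_⟩
    · rw [smul_eq_C_mul]
      simpa [hdeg] using (isHomogeneous_C _ (a : K)⁻¹).mul ((hf.pow (k + 1)).mul hh.1)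
    · have ha' : (a : K) ≠ 0 := Nat.cast_ne_zero.2 ha
      rw [map_smul, h1, smul_eq_C_mul, ← mul_assoc, ← map_natCast C, ← C_mul,
        inv_mul_cancel₀ ha', C_1, one_mul]
  | zero => exact ⟨0, zero_mem _, isHomogeneous_zero _ _ _, map_zero _⟩
  | add r s _ _ hr hs =>
    obtain ⟨q, hq, hq1, hq2⟩ := hr
    obtain ⟨t, ht, ht1, ht2⟩ := hs
    exact ⟨q + t, add_mem hq ht, hq1.add ht1, by rw [map_add, hq2, ht2]⟩
  | smul a r _ hr =>
    obtain ⟨q, hq, hq1, hq2⟩ := hr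
    refine ⟨a • q, Submodule.smul_mem _ _ hq, ?_, by rw [map_smul, hq2]⟩
    rw [smul_eq_C_mul]
    simpa using (isHomogeneous_C _ a).mul hq1

theorem mem_harmonicProducts [CharZero K] (hf : f.IsHomogeneous 2) (hd : (hessian f).det ≠ 0) (d : ℕ) :
    ∀ p : MvPolynomial (Fin (n + 1)) K, p.IsHomogeneous d → p ∈ harmonicProducts f d := by
  induction d using Nat.strong_induction_on with
  | _ d ih =>
  intro p hp
  have harm : ∀ q : MvPolynomial (Fin (n + 1)) K, q.IsHomogeneous d → laplacian f q = 0 →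
      q ∈ harmonicProducts f d := fun q hq hq0 =>
    Submodule.subset_span ⟨0, d, q, ⟨hq, hq0⟩, by omega, by simp⟩
  rcases lt_or_ge d 2 with hlt | hge
  · refine harm p hp ?_
    rw [laplacian_apply]
    refine Finset.sum_eq_zero fun i _ => ?_
    have h := isHomogeneous_raisedPderiv (f := f) hp i
    rw [show d - 1 = 0 by omega, ← totalDegree_zero_iff_isHomogeneous,
      totalDegree_eq_zero_iff_eq_C] at h
    rw [h, pderiv_C]
  · obtain ⟨e, rfl⟩ : ∃ e, d = e + 2 := ⟨d - 2, by omega⟩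
    -- By induction the Laplacian of `p` is also that of some `q` in the span, so `p - q` is
    -- harmonic.
    obtain ⟨q, hq, hq1, hq2⟩ := exists_laplacian_eq hf hd
      (ih e (by omega) _ (isHomogeneous_laplacian hp))
    have := add_mem (harm (p - q) (hp.sub hq1) (by rw [map_sub, hq2, sub_self])) hq
    simpa using this

theorem exists_sub_sum_harmonic_mem [CharZero K] (hf : f.IsHomogeneous 2) (hd : (hessian f).det ≠ 0) (c : K)
    (p : MvPolynomial (Fin (n + 1)) K) :
    ∃ (s : Finset ℕ) (h : ℕ → MvPolynomial (Fin (n + 1)) K), (∀ d, IsHarmonic f d (h d)) ∧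
      p - ∑ d ∈ s, h d ∈ Ideal.span {f - C c} := by
  -- Polynomials with all homogeneous components harmonic; being a subspace, `H` avoids collecting
  -- terms of equal degree by hand.
  let H : Submodule K (MvPolynomial (Fin (n + 1)) K) :=
    ⨅ d, LinearMap.ker (laplacian f ∘ₗ homogeneousComponent d)
  have hH : ∀ q ∈ H, ∀ d, IsHarmonic f d (homogeneousComponent d q) := fun q hq d =>
    ⟨homogeneousComponent_isHomogeneous d q, (Submodule.mem_iInf _).1 hq d⟩
  have hmemH : ∀ (e : ℕ) (h : MvPolynomial (Fin (n + 1)) K), IsHarmonic f e h → h ∈ H := by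
    intro e h hh
    refine (Submodule.mem_iInf _).2 fun d => ?_
    rw [LinearMap.mem_ker, LinearMap.comp_apply, homogeneousComponent_of_mem hh.1]
    split_ifs
    · exact hh.2
    · exact map_zero _
  have htop : ∀ p : MvPolynomial (Fin (n + 1)) K,
      p ∈ H ⊔ (Ideal.span {f - C c}).restrictScalars K := by
    intro p
    rw [← sum_homogeneousComponent p]
    refine Submodule.sum_mem _ fun d _ => ?_
    refine Submodule.span_le.2 ?_
      (mem_harmonicProducts hf hd d _ (homogeneousComponent_isHomogeneous d p))
    rintro _ ⟨k, e, h, hh, -, rfl⟩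
    have h1 : f ^ k * h = c ^ k • h + (f ^ k - C c ^ k) * h := by
      rw [smul_eq_C_mul, map_pow]
      ring
    rw [h1]
    refine Submodule.add_mem_sup (H.smul_mem _ (hmemH e h hh)) ?_
    exact Ideal.mul_mem_right _ _ (Ideal.mem_span_singleton.2 (sub_dvd_pow_sub_pow _ _ _))
  obtain ⟨q, hq, r, hr, hqr⟩ := Submodule.mem_sup.1 (htop p)
  refine ⟨Finset.range (q.totalDegree + 1), fun d => homogeneousComponent d q, hH q hq, ?_⟩
  rw [sum_homogeneousComponent, ← hqr, add_sub_cancel_left]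
  exact hr

theorem casimir_sum_harmonic (hf : f.IsHomogeneous 2) (hd : (hessian f).det ≠ 0)
    {h : ℕ → MvPolynomial (Fin (n + 1)) K} (hh : ∀ d, IsHarmonic f d (h d)) (s : Finset ℕ) :
    casimir f (∑ d ∈ s, h d) =
      ∑ d ∈ s, ((2 * (d * (d - 1) + n * d) : ℕ) : MvPolynomial (Fin (n + 1)) K) * h d := by
  have hrot : ∀ i j (g : ℕ → MvPolynomial (Fin (n + 1)) K),
      rotation f i j (∑ d ∈ s, g d) = ∑ d ∈ s, rotation f i j (g d) := by
    intro i j g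
    simp only [rotation, map_sum, Finset.mul_sum, Finset.sum_sub_distrib]
  simp only [casimir, hrot]
  simp_rw [Finset.sum_comm (t := s)]
  refine Finset.sum_congr rfl fun d _ => ?_
  have := casimir_eq hf hd (hh d).1
  rw [(hh d).2, mul_zero, sub_zero] at this
  exact this

theorem natCast_mul_mem_iff [CharZero K] {A : Type*} [CommRing A] [Algebra K A] {I : Ideal A} {a : ℕ}
    (ha : a ≠ 0) {x : A} : (a : A) * x ∈ I ↔ x ∈ I := by
  refine ⟨fun h => ?_, I.mul_mem_left _⟩
  have h1 := I.mul_mem_left (algebraMap K A (a : K)⁻¹) h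
  rwa [← mul_assoc, ← map_natCast (algebraMap K A) a, ← map_mul,
    inv_mul_cancel₀ (Nat.cast_ne_zero.2 ha), map_one, one_mul] at h1

/-- An ideal stable under the rotations contains the harmonic components of its elements. -/
theorem mem_of_sum_harmonic_mem [CharZero K] (hn : 1 ≤ n) (hf : f.IsHomogeneous 2) (hd : (hessian f).det ≠ 0)
    {I : Ideal (MvPolynomial (Fin (n + 1)) K)}
    (hI : ∀ p ∈ I, ∀ i j, rotation f i j p ∈ I) (s : Finset ℕ) :
    ∀ h : ℕ → MvPolynomial (Fin (n + 1)) K, (∀ d, IsHarmonic f d (h d)) →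
      ∑ d ∈ s, h d ∈ I → ∀ d ∈ s, h d ∈ I := by
  induction s using Finset.induction_on with
  | empty => simp
  | insert a s ha ih =>
    intro h hh hsum
    let μ : ℕ → ℕ := fun d => 2 * (d * (d - 1) + n * d)
    -- Distinct eigenvalues; `n ≥ 1` is needed to separate degrees 0 and 1.
    have hμ : StrictMono μ := by
      refine strictMono_nat_of_lt_succ fun d => ?_
      simp only [μ, Nat.add_sub_cancel]
      have : d * (d - 1) ≤ (d + 1) * d := Nat.mul_le_mul (by omega) (by omega)
      nlinarith
    have hcas : casimir f (∑ d ∈ insert a s, h d) ∈ I :=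
      I.sum_mem fun i _ => I.sum_mem fun j _ => hI _ (hI _ hsum _ _) _ _
    rw [casimir_sum_harmonic hf hd hh] at hcas
    -- Casimir minus `μ a` removes the component of degree `a` and rescales the others by nonzero
    -- scalars.
    have h1 := I.sub_mem hcas (I.mul_mem_left ((μ a : ℕ) : MvPolynomial (Fin (n + 1)) K) hsum)
    rw [Finset.mul_sum, ← Finset.sum_sub_distrib, Finset.sum_insert ha, sub_self, zero_add] at h1
    have h2 := ih (fun d => ((μ d : K) - μ a) • h d) (fun d => ⟨by
      rw [smul_eq_C_mul]
      simpa using (isHomogeneous_C _ ((μ d : K) - μ a)).mul (hh d).1, by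
      rw [map_smul, (hh d).2, smul_zero]⟩) (by
      convert h1 using 2 with d
      simp only [smul_eq_C_mul, map_sub, map_natCast, sub_mul, μ])
    have h3 : ∀ d ∈ s, h d ∈ I := by
      intro d hds
      have hne : ((μ d : K) - μ a) ≠ 0 := by
        rw [sub_ne_zero, Nat.cast_injective.ne_iff]
        exact hμ.injective.ne (fun h => ha (h ▸ hds))
      have := (I.restrictScalars K).smul_mem ((μ d : K) - μ a)⁻¹ (h2 d hds)
      rwa [inv_smul_smul₀ hne] at this
    intro d hds
    rcases Finset.mem_insert.1 hds with rfl | hds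
    · rw [Finset.sum_insert ha] at hsum
      exact (I.add_mem_iff_left (I.sum_mem h3)).1 hsum
    · exact h3 d hds

end Decomposition

/-! ### Centrality and simplicity of the quotient. -/

section Main

variable {K : Type*} [Field K] {n : ℕ} {f : MvPolynomial (Fin (n + 1)) K}

/-- Only the brackets of `p`, not `p` itself, must lie in `I`; this also covers representatives of
central elements. -/
theorem rotation_mem (hf : f.IsHomogeneous 2) (hd : (hessian f).det ≠ 0)
    {I : Ideal (MvPolynomial (Fin (n + 1)) K)} {p : MvPolynomial (Fin (n + 1)) K}
    (hp : ∀ (v : Fin n → MvPolynomial (Fin (n + 1)) K) (i : Fin n),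
      polyBracket f (Function.update v i p) ∈ I) (i j : Fin (n + 1)) : rotation f i j p ∈ I := by
  rw [rotation_eq hf hd]
  exact I.sum_mem fun k _ => I.mul_mem_left _ (IsPoissonIdeal.pderiv_mul_sub_mem hf hp k j)

theorem IsPoissonIdeal.rotation_mem (hf : f.IsHomogeneous 2) (hd : (hessian f).det ≠ 0)
    {I : Ideal (MvPolynomial (Fin (n + 1)) K)} (hI : IsPoissonIdeal (polyBracket f) I)
    {p : MvPolynomial (Fin (n + 1)) K} (hp : p ∈ I) (i j : Fin (n + 1)) :
    rotation f i j p ∈ I :=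
  NLie.rotation_mem hf hd (fun v k => hI _ k (by simpa using hp)) i j

theorem pderiv_mem_of_isHomogeneous [CharZero K] (hf : f.IsHomogeneous 2) (hd : (hessian f).det ≠ 0)
    {I : Ideal (MvPolynomial (Fin (n + 1)) K)} (hI : IsPoissonIdeal (polyBracket f) I)
    {c : K} (hc : c ≠ 0) (hfc : f - C c ∈ I) {d : ℕ} {p : MvPolynomial (Fin (n + 1)) K}
    (hp : p.IsHomogeneous d) (hpI : p ∈ I) (j : Fin (n + 1)) : pderiv j p ∈ I := by
  have hr : ∀ i, raisedPderiv f i p ∈ I := by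
    intro i
    -- Contracting the rotations with `X j` isolates `2 f ∂ⁱ p` modulo `p`; since `f ≡ c ≠ 0`, the
    -- factor `2 f` can be cancelled.
    have h1 : ∑ j, X j * rotation f i j p =
        X i * ((d : MvPolynomial (Fin (n + 1)) K) * p) - 2 * f * raisedPderiv f i p := by
      rw [← sum_X_mul_pderiv hp, ← sum_X_mul_pderiv_quad hf, Finset.mul_sum, Finset.sum_mul,
        ← Finset.sum_sub_distrib]
      refine Finset.sum_congr rfl fun j _ => ?_
      rw [rotation]
      ring
    have h2 : ∑ j, X j * rotation f i j p ∈ I :=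
      I.sum_mem fun j _ => I.mul_mem_left _ (hI.rotation_mem hf hd hpI i j)
    rw [h1, ← mul_assoc] at h2
    have h3 : C (2 * c) * raisedPderiv f i p ∈ I := by
      have h4 := I.sub_mem (I.sub_mem (I.mul_mem_left (X i * (d : MvPolynomial (Fin (n + 1)) K))
        hpI) h2) (I.mul_mem_left (2 * raisedPderiv f i p) hfc)
      convert h4 using 1
      rw [C_mul, map_ofNat]
      ring
    have h5 := I.mul_mem_left (C (2 * c)⁻¹) h3
    rwa [← mul_assoc, ← C_mul, inv_mul_cancel₀ (mul_ne_zero two_ne_zero hc), C_1, one_mul] at h5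
  rw [← sum_hessian_mul_raisedPderiv hd j p]
  exact I.sum_mem fun i _ => I.mul_mem_left _ (hr i)

theorem eq_top_of_isHomogeneous_mem [CharZero K] (hf : f.IsHomogeneous 2) (hd : (hessian f).det ≠ 0)
    {I : Ideal (MvPolynomial (Fin (n + 1)) K)} (hI : IsPoissonIdeal (polyBracket f) I)
    {c : K} (hc : c ≠ 0) (hfc : f - C c ∈ I) (d : ℕ) :
    ∀ p : MvPolynomial (Fin (n + 1)) K, p.IsHomogeneous d → p ∈ I → p ≠ 0 → I = ⊤ := by
  induction d with
  | zero =>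
    intro p hp hpI hp0
    rw [← totalDegree_zero_iff_isHomogeneous, totalDegree_eq_zero_iff_eq_C] at hp
    rw [hp] at hpI hp0
    refine Ideal.eq_top_of_isUnit_mem _ hpI ((isUnit_iff_ne_zero.2 fun h => hp0 ?_).map C)
    rw [h, C_0]
  | succ d ih =>
    intro p hp hpI hp0
    obtain ⟨j, hj⟩ : ∃ j, pderiv j p ≠ 0 := by
      by_contra! h
      have h1 := sum_X_mul_pderiv hp
      simp only [h, mul_zero, Finset.sum_const_zero] at h1
      rcases mul_eq_zero.1 h1.symm with h2 | h2
      · exact Nat.cast_ne_zero.2 (Nat.succ_ne_zero d) h2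
      · exact hp0 h2
    exact ih _ hp.pderiv (pderiv_mem_of_isHomogeneous hf hd hI hc hfc hp hpI j) hj

theorem span_sub_C_ne_top [CharZero K] (hf : f.IsHomogeneous 2) (hd : (hessian f).det ≠ 0) (c : K) :
    Ideal.span {f - C c} ≠ ⊤ := by
  intro h
  rw [Ideal.span_singleton_eq_top] at h
  have hc := ((isUnit_iff_totalDegree_of_isReduced).1 h).2
  rw [totalDegree_eq_zero_iff_eq_C] at hc
  have hz : ∀ i, pderiv i f = 0 := by
    intro i
    have := congrArg (pderiv i) hc
    simpa using this
  -- If `f - c` were a unit, `f` would be constant, but its second derivatives do not all vanish.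
  have := raisedPderiv_pderiv_quad hf hd 0 0
  rw [hz, map_zero, if_pos rfl] at this
  exact zero_ne_one this

theorem isSimplePoisson_quotientBracket [CharZero K] (hn : 1 ≤ n) (hf : f.IsHomogeneous 2)
    (hd : (hessian f).det ≠ 0) {c : K} (hc : c ≠ 0)
    (h : IsPoissonIdeal (polyBracket f) (Ideal.span {f - C c})) :
    IsSimplePoisson (quotientBracket (polyBracket f) _ h) := by
  refine ⟨Ideal.Quotient.nontrivial_iff.2 (span_sub_C_ne_top hf hd c), fun I hI => ?_⟩
  rw [or_iff_not_imp_left]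
  intro hbot
  have hP := IsPoissonIdeal.comap_mk h hI
  set L := I.comap (Ideal.Quotient.mk (Ideal.span {f - C c})) with hL
  have hle : Ideal.span {f - C c} ≤ L := by
    intro x hx
    rw [hL, Ideal.mem_comap, Ideal.Quotient.eq_zero_iff_mem.2 hx]
    exact I.zero_mem
  obtain ⟨q, hq, hq0⟩ := Submodule.exists_mem_ne_zero_of_ne_bot hbot
  obtain ⟨p, rfl⟩ := Ideal.Quotient.mk_surjective q
  obtain ⟨s, g, hg, hps⟩ := exists_sub_sum_harmonic_mem hf hd c p
  have hpL : p ∈ L := hq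
  have hsL : ∑ d ∈ s, g d ∈ L := by
    have := L.sub_mem hpL (hle hps)
    rwa [sub_sub_cancel] at this
  have hmem := mem_of_sum_harmonic_mem hn hf hd (fun p hp => hP.rotation_mem hf hd hp) s g hg hsL
  obtain ⟨d, hds, hgd⟩ : ∃ d ∈ s, g d ≠ 0 := by
    by_contra! hall
    rw [Finset.sum_eq_zero hall, sub_zero] at hps
    exact hq0 (Ideal.Quotient.eq_zero_iff_mem.2 hps)
  have hLtop : L = ⊤ := eq_top_of_isHomogeneous_mem hf hd hP hc
    (hle (Ideal.mem_span_singleton_self _)) d _ (hg d).1 (hmem d hds) hgd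
  rw [Ideal.eq_top_iff_one, hL, Ideal.mem_comap, map_one] at hLtop
  exact I.eq_top_iff_one.2 hLtop

theorem isCentral_quotientBracket [CharZero K] (hn : 1 ≤ n) (hf : f.IsHomogeneous 2)
    (hd : (hessian f).det ≠ 0) (c : K)
    (h : IsPoissonIdeal (polyBracket f) (Ideal.span {f - C c})) :
    IsCentral (quotientBracket (polyBracket f) _ h) := by
  apply Set.Subset.antisymm
  · intro q hq
    obtain ⟨p, rfl⟩ := Ideal.Quotient.mk_surjective q
    obtain ⟨s, g, hg, hps⟩ := exists_sub_sum_harmonic_mem hf hd c p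
    set J := Ideal.span {f - C c} with hJ
    have hstable : ∀ p ∈ J, ∀ i j, rotation f i j p ∈ J := fun p hp => h.rotation_mem hf hd hp
    have hrot : ∀ i j, rotation f i j (∑ d ∈ s, g d) ∈ J := by
      intro i j
      -- Rotations send `p` into `J` by centrality and `p - ∑ g d` into `J` by stability.
      have h1 := rotation_mem hf hd (mk_mem_center_quotientBracket h hq) i j
      have h2 := hstable _ hps i j
      have h3 := J.sub_mem h1 h2
      convert h3 using 1
      simp only [rotation, map_sub]
      ring
    have hcas : casimir f (∑ d ∈ s, g d) ∈ J :=
      J.sum_mem fun i _ => J.sum_mem fun j _ => hstable _ (hrot _ _) _ _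
    rw [casimir_sum_harmonic hf hd hg] at hcas
    have hmem := mem_of_sum_harmonic_mem hn hf hd hstable s
      (fun d => ((2 * (d * (d - 1) + n * d) : ℕ) : MvPolynomial (Fin (n + 1)) K) * g d)
      (fun d => by
        rw [← map_natCast C, ← smul_eq_C_mul]
        refine ⟨?_, by rw [map_smul, (hg d).2, smul_zero]⟩
        rw [smul_eq_C_mul]
        simpa only [zero_add] using (isHomogeneous_C _ _).mul (hg d).1) hcas
    -- The Casimir eigenvalue is nonzero in every positive degree.
    have hpos : ∀ d ∈ s, d ≠ 0 → g d ∈ J := by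
      intro d hds hd0
      refine (natCast_mul_mem_iff (K := K) ?_).1 (hmem d hds)
      have : 0 < n * d := Nat.mul_pos hn (Nat.pos_of_ne_zero hd0)
      omega
    have hconst : ∃ a : K, ∑ d ∈ s, g d - C a ∈ J := by
      have h0 := (hg 0).1
      rw [← totalDegree_zero_iff_isHomogeneous, totalDegree_eq_zero_iff_eq_C] at h0
      by_cases hs : 0 ∈ s
      · refine ⟨coeff 0 (g 0), ?_⟩
        rw [← Finset.add_sum_erase _ _ hs, ← h0, add_sub_cancel_left]
        exact J.sum_mem fun d hd => hpos d (Finset.mem_of_mem_erase hd) (Finset.ne_of_mem_erase hd)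
      · refine ⟨0, ?_⟩
        rw [C_0, sub_zero]
        exact J.sum_mem fun d hd => hpos d hd fun hd0 => hs (hd0 ▸ hd)
    obtain ⟨a, ha⟩ := hconst
    refine ⟨a, ?_⟩
    have h1 := J.add_mem hps ha
    rw [sub_add_sub_cancel] at h1
    exact (Ideal.Quotient.eq.2 h1).symm
  · rintro _ ⟨a, rfl⟩ v i
    obtain ⟨v, rfl⟩ := exists_eq_mk v
    have h1 : algebraMap K (MvPolynomial (Fin (n + 1)) K ⧸ Ideal.span {f - C c}) a =
        Ideal.Quotient.mk _ (algebraMap K _ a) := rfl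
    rw [h1, quotientBracket_update_mk, polyBracket_update hf, ← jacDerivation_apply,
      Derivation.map_algebraMap, map_zero]

end Main

end NLie

theorem corollary3 {K : Type*} [Field K] [CharZero K] (n : ℕ) (hn : 2 ≤ n)
    (f : MvPolynomial (Fin (n + 1)) K) (hf : f.IsHomogeneous 2)
    (hnd : NLie.IsNondegenerate f) :
    NLie.IsNLie (NLie.quadBracket f) ∧
    NLie.IsSimpleNAry (NLie.quadBracket f) ∧
    ∀ c : K, c ≠ 0 →
      ∃ h : NLie.IsPoissonIdeal (NLie.polyBracket f) (Ideal.span {f - MvPolynomial.C c}),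
        NLie.IsNLiePoisson (NLie.quotientBracket (NLie.polyBracket f) _ h) ∧
        NLie.IsCentral (NLie.quotientBracket (NLie.polyBracket f) _ h) ∧
        NLie.IsSimplePoisson (NLie.quotientBracket (NLie.polyBracket f) _ h) := by
  have hd := NLie.det_hessian_ne_zero hf hnd
  have hn1 : 1 ≤ n := by omega
  refine ⟨NLie.quadBracket_isNLie hf, NLie.quadBracket_isSimple hn hf hnd, fun c hc => ?_⟩
  have h := NLie.isPoissonIdeal_span_sub_C hf c
  exact ⟨h, (NLie.polyBracket_isNLiePoisson hf).quotientBracket h,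
    NLie.isCentral_quotientBracket hn1 hf hd c h,
    NLie.isSimplePoisson_quotientBracket hn1 hf hd hc h⟩
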